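/- Let $\mathfrak g=\mathfrak{sl}_6(\mathbb C)$ with its diagonal Cartan subalgebra $\mathfrak h$, let $\mathfrak n_+$ be the strictly upper triangular matrices, and let $\langle x,y\rangle=\operatorname{tr}(xy)$ (the normalized invariant form). For $1\le i<j\le 6$ let $e_{i,j}$ be the matrix unit with entry $1$ in row $i$ and column $j$, let $f_{i,j}$ be its transpose, and let $h_i=[e_{i,i+1},f_{i,i+1}]$ ($1\le i\le 5$); let $\omega_1,\dots,\omega_5$ be the fundamental weights. Let $\hat{\mathfrak g}=\mathfrak g\otimes\mathbb C[t,t^{-1}]\oplus\mathbb CK$ be the affine Lie algebra, with $K$ central and $[x(m),y(n)]=[x,y](m+n)+m\,\delta_{m+n,0}\langle x,y\rangle K$, where $x(n)=x\otimes t^n$. For $k\in\mathbb C$ let $V^k(\mathfrak g)$ be the universal affine vertex algebra of level $k$, i.e. the $\hat{\mathfrak g}$-module $U(\hat{\mathfrak g})\otimes_{U(\mathfrak g\otimes\mathbb C[t]\oplus\mathbb CK)}\mathbb C_k$ generated by the vacuum vector $\mathbf 1$, with $\mathfrak g\otimes\mathbb C[t]$ acting on $\mathbb C_k=\mathbb C\mathbf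 1$ by $0$ and $K$ by $k$; let $d$ be the operator on it with $d\mathbf 1=0$ and $[d,x(n)]=n\,x(n)$. Weights are linear functionals on $\mathfrak h\oplus\mathbb CK\oplus\mathbb Cd$, where $\Lambda_0(K)=1$, $\Lambda_0(\mathfrak h)=\Lambda_0(d)=0$, $\delta(d)=1$, $\delta(\mathfrak h)=\delta(K)=0$, and $\omega_i(K)=\omega_i(d)=0$. A singular vector is a nonzero vector annihilated by $\mathfrak n_+\otimes 1$ and by $\mathfrak g\otimes t\,\mathbb C[t]$. The conformal weight is the eigenvalue of the Sugawara operator $L(0)=\frac1{2(k+6)}\sum_i\bigl(x_i(0)y_i(0)+2\sum_{n\ge1}x_i(-n)y_i(n)\bigr)$, where $(x_i),(y_i)$ are dual bases of $\mathfrak g$ with respect to $\langle\cdot,\cdot\rangle$. **Theorem.** The following vector $v$ is a singular vector in $V^{-7/2}(\mathfrak{sl}_6)$ of weight $-\tfrac72\Lambda_0-4\delta+\omega_2+\omega_4$; its conformal weight is $4$. In particular $v\neq0$, $e_{i,i+1}(0)v=0$ for $i=1,\dots,5$, and $f_{1,6}(1)v=0$. $$ \begin{aligned} v={}&e_{1,5}(-3)e_{2,6}(-1)\mathbf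 1 +\tfrac{5}{2}e_{1,5}(-2)e_{2,6}(-2)\mathbf 1 -e_{1,6}(-3)e_{2,5}(-1)\mathbf 1 -\tfrac{5}{2}e_{1,6}(-2)e_{2,5}(-2)\mathbf 1 \\ &-e_{2,5}(-3)e_{1,6}(-1)\mathbf 1 +e_{2,6}(-3)e_{1,5}(-1)\mathbf 1 -\tfrac{7}{5}e_{1,5}(-2)e_{1,6}(-1)f_{1,2}(-1)\mathbf 1 -\tfrac{5}{3}e_{1,5}(-2)e_{2,3}(-1)e_{3,6}(-1)\mathbf 1 \\ &-\tfrac{5}{3}e_{1,5}(-2)e_{2,4}(-1)e_{4,6}(-1)\mathbf 1 -\tfrac{5}{3}e_{1,5}(-2)e_{2,5}(-1)e_{5,6}(-1)\mathbf 1 -e_{1,5}(-2)e_{2,6}(-1)h_2(-1)\mathbf 1 -\tfrac{1}{3}e_{1,5}(-2)e_{2,6}(-1)h_3(-1)\mathbf 1 \\ &+\tfrac{1}{3}e_{1,5}(-2)e_{2,6}(-1)h_4(-1)\mathbf 1 +e_{1,5}(-2)e_{2,6}(-1)h_5(-1)\mathbf 1 -\tfrac{2}{5}e_{1,5}(-1)e_{2,6}(-1)h_2(-2)\mathbf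 1 +\tfrac{2}{15}e_{1,5}(-1)e_{2,6}(-1)h_3(-2)\mathbf 1 \\ &-\tfrac{2}{5}e_{1,5}(-1)e_{2,6}(-1)h_4(-2)\mathbf 1 +\tfrac{7}{5}e_{1,6}(-2)e_{1,5}(-1)f_{1,2}(-1)\mathbf 1 +\tfrac{5}{3}e_{1,6}(-2)e_{2,3}(-1)e_{3,5}(-1)\mathbf 1 +\tfrac{5}{3}e_{1,6}(-2)e_{2,4}(-1)e_{4,5}(-1)\mathbf 1 \\ &+e_{1,6}(-2)e_{2,5}(-1)h_2(-1)\mathbf 1 +\tfrac{1}{3}e_{1,6}(-2)e_{2,5}(-1)h_3(-1)\mathbf 1 -\tfrac{1}{3}e_{1,6}(-2)e_{2,5}(-1)h_4(-1)\mathbf 1 +\tfrac{2}{3}e_{1,6}(-2)e_{2,5}(-1)h_5(-1)\mathbf 1 \\ &+\tfrac{5}{3}e_{1,6}(-2)e_{2,6}(-1)f_{5,6}(-1)\mathbf 1 +\tfrac{2}{5}e_{1,6}(-1)e_{2,5}(-1)h_2(-2)\mathbf 1 -\tfrac{2}{15}e_{1,6}(-1)e_{2,5}(-1)h_3(-2)\mathbf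 1 +\tfrac{2}{5}e_{1,6}(-1)e_{2,5}(-1)h_4(-2)\mathbf 1 \\ &-\tfrac{2}{3}e_{2,3}(-2)e_{1,5}(-1)e_{3,6}(-1)\mathbf 1 +\tfrac{2}{3}e_{2,3}(-2)e_{1,6}(-1)e_{3,5}(-1)\mathbf 1 -\tfrac{2}{3}e_{2,4}(-2)e_{1,5}(-1)e_{4,6}(-1)\mathbf 1 +\tfrac{2}{3}e_{2,4}(-2)e_{1,6}(-1)e_{4,5}(-1)\mathbf 1 \\ &+e_{2,5}(-2)e_{1,2}(-1)e_{2,6}(-1)\mathbf 1 +e_{2,5}(-2)e_{1,3}(-1)e_{3,6}(-1)\mathbf 1 +e_{2,5}(-2)e_{1,4}(-1)e_{4,6}(-1)\mathbf 1 +\tfrac{1}{3}e_{2,5}(-2)e_{1,5}(-1)e_{5,6}(-1)\mathbf 1 \\ &+e_{2,5}(-2)e_{1,6}(-1)h_1(-1)\mathbf 1 +e_{2,5}(-2)e_{1,6}(-1)h_2(-1)\mathbf 1 +\tfrac{1}{3}e_{2,5}(-2)e_{1,6}(-1)h_3(-1)\mathbf 1 -\tfrac{1}{3}e_{2,5}(-2)e_{1,6}(-1)h_4(-1)\mathbf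 1 \\ &-\tfrac{1}{3}e_{2,5}(-2)e_{1,6}(-1)h_5(-1)\mathbf 1 -e_{2,6}(-2)e_{1,2}(-1)e_{2,5}(-1)\mathbf 1 -e_{2,6}(-2)e_{1,3}(-1)e_{3,5}(-1)\mathbf 1 -e_{2,6}(-2)e_{1,4}(-1)e_{4,5}(-1)\mathbf 1 \\ &-e_{2,6}(-2)e_{1,5}(-1)h_1(-1)\mathbf 1 -e_{2,6}(-2)e_{1,5}(-1)h_2(-1)\mathbf 1 -\tfrac{1}{3}e_{2,6}(-2)e_{1,5}(-1)h_3(-1)\mathbf 1 +\tfrac{1}{3}e_{2,6}(-2)e_{1,5}(-1)h_4(-1)\mathbf 1 \\ &-\tfrac{1}{3}e_{2,6}(-2)e_{1,6}(-1)f_{5,6}(-1)\mathbf 1 -\tfrac{2}{3}e_{3,5}(-2)e_{1,3}(-1)e_{2,6}(-1)\mathbf 1 +\tfrac{2}{3}e_{3,5}(-2)e_{1,6}(-1)e_{2,3}(-1)\mathbf 1 +\tfrac{2}{3}e_{3,6}(-2)e_{1,3}(-1)e_{2,5}(-1)\mathbf 1 \\ &-\tfrac{2}{3}e_{3,6}(-2)e_{1,5}(-1)e_{2,3}(-1)\mathbf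 1 +\tfrac{2}{3}e_{4,5}(-2)e_{1,4}(-1)e_{2,6}(-1)\mathbf 1 -\tfrac{2}{3}e_{4,5}(-2)e_{1,6}(-1)e_{2,4}(-1)\mathbf 1 -\tfrac{2}{3}e_{4,6}(-2)e_{1,4}(-1)e_{2,5}(-1)\mathbf 1 \\ &+\tfrac{2}{3}e_{4,6}(-2)e_{1,5}(-1)e_{2,4}(-1)\mathbf 1 -\tfrac{2}{5}e_{1,2}(-1)e_{1,5}(-1)e_{2,6}(-1)f_{1,2}(-1)\mathbf 1 +\tfrac{2}{5}e_{1,2}(-1)e_{1,6}(-1)e_{2,5}(-1)f_{1,2}(-1)\mathbf 1 +\tfrac{2}{3}e_{1,2}(-1)e_{2,3}(-1)e_{2,5}(-1)e_{3,6}(-1)\mathbf 1 \\ &-\tfrac{2}{3}e_{1,2}(-1)e_{2,3}(-1)e_{2,6}(-1)e_{3,5}(-1)\mathbf 1 +\tfrac{2}{3}e_{1,2}(-1)e_{2,4}(-1)e_{2,5}(-1)e_{4,6}(-1)\mathbf 1 -\tfrac{2}{3}e_{1,2}(-1)e_{2,4}(-1)e_{2,6}(-1)e_{4,5}(-1)\mathbf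 1 +\tfrac{2}{3}e_{1,2}(-1)e_{2,5}(-1)^2e_{5,6}(-1)\mathbf 1 \\ &-\tfrac{2}{3}e_{1,2}(-1)e_{2,5}(-1)e_{2,6}(-1)h_5(-1)\mathbf 1 -\tfrac{2}{3}e_{1,2}(-1)e_{2,6}(-1)^2f_{5,6}(-1)\mathbf 1 +\tfrac{4}{15}e_{1,3}(-1)e_{1,5}(-1)e_{2,6}(-1)f_{1,3}(-1)\mathbf 1 -\tfrac{2}{3}e_{1,3}(-1)e_{1,5}(-1)e_{3,6}(-1)f_{1,2}(-1)\mathbf 1 \\ &-\tfrac{4}{15}e_{1,3}(-1)e_{1,6}(-1)e_{2,5}(-1)f_{1,3}(-1)\mathbf 1 +\tfrac{2}{3}e_{1,3}(-1)e_{1,6}(-1)e_{3,5}(-1)f_{1,2}(-1)\mathbf 1 +2e_{1,3}(-1)e_{2,4}(-1)e_{3,5}(-1)e_{4,6}(-1)\mathbf 1 -2e_{1,3}(-1)e_{2,4}(-1)e_{3,6}(-1)e_{4,5}(-1)\mathbf 1 \\ &-\tfrac{4}{3}e_{1,3}(-1)e_{2,5}(-1)e_{3,4}(-1)e_{4,6}(-1)\mathbf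 1 +\tfrac{2}{3}e_{1,3}(-1)e_{2,5}(-1)e_{3,5}(-1)e_{5,6}(-1)\mathbf 1 -\tfrac{2}{3}e_{1,3}(-1)e_{2,5}(-1)e_{3,6}(-1)h_2(-1)\mathbf 1 -\tfrac{2}{3}e_{1,3}(-1)e_{2,5}(-1)e_{3,6}(-1)h_3(-1)\mathbf 1 \\ &+\tfrac{2}{3}e_{1,3}(-1)e_{2,5}(-1)e_{3,6}(-1)h_4(-1)\mathbf 1 +\tfrac{4}{3}e_{1,3}(-1)e_{2,6}(-1)e_{3,4}(-1)e_{4,5}(-1)\mathbf 1 +\tfrac{2}{3}e_{1,3}(-1)e_{2,6}(-1)e_{3,5}(-1)h_2(-1)\mathbf 1 +\tfrac{2}{3}e_{1,3}(-1)e_{2,6}(-1)e_{3,5}(-1)h_3(-1)\mathbf 1 \\ &-\tfrac{2}{3}e_{1,3}(-1)e_{2,6}(-1)e_{3,5}(-1)h_4(-1)\mathbf 1 -\tfrac{2}{3}e_{1,3}(-1)e_{2,6}(-1)e_{3,5}(-1)h_5(-1)\mathbf 1 -\tfrac{2}{3}e_{1,3}(-1)e_{2,6}(-1)e_{3,6}(-1)f_{5,6}(-1)\mathbf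 1 +\tfrac{4}{15}e_{1,4}(-1)e_{1,5}(-1)e_{2,6}(-1)f_{1,4}(-1)\mathbf 1 \\ &-\tfrac{2}{3}e_{1,4}(-1)e_{1,5}(-1)e_{4,6}(-1)f_{1,2}(-1)\mathbf 1 -\tfrac{4}{15}e_{1,4}(-1)e_{1,6}(-1)e_{2,5}(-1)f_{1,4}(-1)\mathbf 1 +\tfrac{2}{3}e_{1,4}(-1)e_{1,6}(-1)e_{4,5}(-1)f_{1,2}(-1)\mathbf 1 -2e_{1,4}(-1)e_{2,3}(-1)e_{3,5}(-1)e_{4,6}(-1)\mathbf 1 \\ &+2e_{1,4}(-1)e_{2,3}(-1)e_{3,6}(-1)e_{4,5}(-1)\mathbf 1 -\tfrac{4}{3}e_{1,4}(-1)e_{2,5}(-1)e_{3,6}(-1)f_{3,4}(-1)\mathbf 1 +\tfrac{2}{3}e_{1,4}(-1)e_{2,5}(-1)e_{4,5}(-1)e_{5,6}(-1)\mathbf 1 -\tfrac{2}{3}e_{1,4}(-1)e_{2,5}(-1)e_{4,6}(-1)h_2(-1)\mathbf 1 \\ &+\tfrac{2}{3}e_{1,4}(-1)e_{2,5}(-1)e_{4,6}(-1)h_3(-1)\mathbf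 1 +\tfrac{2}{3}e_{1,4}(-1)e_{2,5}(-1)e_{4,6}(-1)h_4(-1)\mathbf 1 +\tfrac{4}{3}e_{1,4}(-1)e_{2,6}(-1)e_{3,5}(-1)f_{3,4}(-1)\mathbf 1 +\tfrac{2}{3}e_{1,4}(-1)e_{2,6}(-1)e_{4,5}(-1)h_2(-1)\mathbf 1 \\ &-\tfrac{2}{3}e_{1,4}(-1)e_{2,6}(-1)e_{4,5}(-1)h_3(-1)\mathbf 1 -\tfrac{2}{3}e_{1,4}(-1)e_{2,6}(-1)e_{4,5}(-1)h_4(-1)\mathbf 1 -\tfrac{2}{3}e_{1,4}(-1)e_{2,6}(-1)e_{4,5}(-1)h_5(-1)\mathbf 1 -\tfrac{2}{3}e_{1,4}(-1)e_{2,6}(-1)e_{4,6}(-1)f_{5,6}(-1)\mathbf 1 \\ &+\tfrac{4}{15}e_{1,5}(-1)^2e_{2,6}(-1)f_{1,5}(-1)\mathbf 1 -\tfrac{2}{3}e_{1,5}(-1)^2e_{5,6}(-1)f_{1,2}(-1)\mathbf 1 -\tfrac{4}{15}e_{1,5}(-1)e_{1,6}(-1)e_{2,5}(-1)f_{1,5}(-1)\mathbf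 1 +\tfrac{4}{15}e_{1,5}(-1)e_{1,6}(-1)e_{2,6}(-1)f_{1,6}(-1)\mathbf 1 \\ &+\tfrac{2}{3}e_{1,5}(-1)e_{1,6}(-1)f_{1,2}(-1)h_5(-1)\mathbf 1 +\tfrac{4}{15}e_{1,5}(-1)e_{2,3}(-1)e_{2,6}(-1)f_{2,3}(-1)\mathbf 1 +\tfrac{4}{3}e_{1,5}(-1)e_{2,3}(-1)e_{3,4}(-1)e_{4,6}(-1)\mathbf 1 -\tfrac{2}{3}e_{1,5}(-1)e_{2,3}(-1)e_{3,5}(-1)e_{5,6}(-1)\mathbf 1 \\ &+\tfrac{2}{3}e_{1,5}(-1)e_{2,3}(-1)e_{3,6}(-1)h_1(-1)\mathbf 1 +\tfrac{2}{3}e_{1,5}(-1)e_{2,3}(-1)e_{3,6}(-1)h_2(-1)\mathbf 1 +\tfrac{2}{3}e_{1,5}(-1)e_{2,3}(-1)e_{3,6}(-1)h_3(-1)\mathbf 1 -\tfrac{2}{3}e_{1,5}(-1)e_{2,3}(-1)e_{3,6}(-1)h_4(-1)\mathbf 1 \\ &+\tfrac{4}{15}e_{1,5}(-1)e_{2,4}(-1)e_{2,6}(-1)f_{2,4}(-1)\mathbf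 1 +\tfrac{4}{3}e_{1,5}(-1)e_{2,4}(-1)e_{3,6}(-1)f_{3,4}(-1)\mathbf 1 -\tfrac{2}{3}e_{1,5}(-1)e_{2,4}(-1)e_{4,5}(-1)e_{5,6}(-1)\mathbf 1 +\tfrac{2}{3}e_{1,5}(-1)e_{2,4}(-1)e_{4,6}(-1)h_1(-1)\mathbf 1 \\ &+\tfrac{2}{3}e_{1,5}(-1)e_{2,4}(-1)e_{4,6}(-1)h_2(-1)\mathbf 1 -\tfrac{2}{3}e_{1,5}(-1)e_{2,4}(-1)e_{4,6}(-1)h_3(-1)\mathbf 1 -\tfrac{2}{3}e_{1,5}(-1)e_{2,4}(-1)e_{4,6}(-1)h_4(-1)\mathbf 1 +\tfrac{4}{15}e_{1,5}(-1)e_{2,5}(-1)e_{2,6}(-1)f_{2,5}(-1)\mathbf 1 \\ &+\tfrac{2}{3}e_{1,5}(-1)e_{2,5}(-1)e_{5,6}(-1)h_1(-1)\mathbf 1 +\tfrac{4}{15}e_{1,5}(-1)e_{2,6}(-1)^2f_{2,6}(-1)\mathbf 1 -\tfrac{16}{15}e_{1,5}(-1)e_{2,6}(-1)e_{3,4}(-1)f_{3,4}(-1)\mathbf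 1 +\tfrac{4}{15}e_{1,5}(-1)e_{2,6}(-1)e_{3,5}(-1)f_{3,5}(-1)\mathbf 1 \\ &+\tfrac{4}{15}e_{1,5}(-1)e_{2,6}(-1)e_{3,6}(-1)f_{3,6}(-1)\mathbf 1 +\tfrac{4}{15}e_{1,5}(-1)e_{2,6}(-1)e_{4,5}(-1)f_{4,5}(-1)\mathbf 1 +\tfrac{4}{15}e_{1,5}(-1)e_{2,6}(-1)e_{4,6}(-1)f_{4,6}(-1)\mathbf 1 -\tfrac{2}{5}e_{1,5}(-1)e_{2,6}(-1)e_{5,6}(-1)f_{5,6}(-1)\mathbf 1 \\ &+\tfrac{2}{5}e_{1,5}(-1)e_{2,6}(-1)h_1(-1)h_2(-1)\mathbf 1 +\tfrac{2}{15}e_{1,5}(-1)e_{2,6}(-1)h_1(-1)h_3(-1)\mathbf 1 -\tfrac{2}{15}e_{1,5}(-1)e_{2,6}(-1)h_1(-1)h_4(-1)\mathbf 1 -\tfrac{2}{5}e_{1,5}(-1)e_{2,6}(-1)h_1(-1)h_5(-1)\mathbf 1 \\ &+\tfrac{2}{5}e_{1,5}(-1)e_{2,6}(-1)h_2(-1)^2\mathbf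 1 +\tfrac{4}{15}e_{1,5}(-1)e_{2,6}(-1)h_2(-1)h_3(-1)\mathbf 1 -\tfrac{4}{15}e_{1,5}(-1)e_{2,6}(-1)h_2(-1)h_4(-1)\mathbf 1 -\tfrac{2}{15}e_{1,5}(-1)e_{2,6}(-1)h_2(-1)h_5(-1)\mathbf 1 \\ &-\tfrac{2}{15}e_{1,5}(-1)e_{2,6}(-1)h_3(-1)^2\mathbf 1 +\tfrac{4}{15}e_{1,5}(-1)e_{2,6}(-1)h_3(-1)h_4(-1)\mathbf 1 +\tfrac{2}{15}e_{1,5}(-1)e_{2,6}(-1)h_3(-1)h_5(-1)\mathbf 1 +\tfrac{2}{5}e_{1,5}(-1)e_{2,6}(-1)h_4(-1)^2\mathbf 1 \\ &+\tfrac{2}{5}e_{1,5}(-1)e_{2,6}(-1)h_4(-1)h_5(-1)\mathbf 1 -\tfrac{4}{15}e_{1,6}(-1)^2e_{2,5}(-1)f_{1,6}(-1)\mathbf 1 +\tfrac{2}{3}e_{1,6}(-1)^2f_{1,2}(-1)f_{5,6}(-1)\mathbf 1 -\tfrac{4}{15}e_{1,6}(-1)e_{2,3}(-1)e_{2,5}(-1)f_{2,3}(-1)\mathbf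 1 \\ &-\tfrac{4}{3}e_{1,6}(-1)e_{2,3}(-1)e_{3,4}(-1)e_{4,5}(-1)\mathbf 1 -\tfrac{2}{3}e_{1,6}(-1)e_{2,3}(-1)e_{3,5}(-1)h_1(-1)\mathbf 1 -\tfrac{2}{3}e_{1,6}(-1)e_{2,3}(-1)e_{3,5}(-1)h_2(-1)\mathbf 1 -\tfrac{2}{3}e_{1,6}(-1)e_{2,3}(-1)e_{3,5}(-1)h_3(-1)\mathbf 1 \\ &+\tfrac{2}{3}e_{1,6}(-1)e_{2,3}(-1)e_{3,5}(-1)h_4(-1)\mathbf 1 +\tfrac{2}{3}e_{1,6}(-1)e_{2,3}(-1)e_{3,5}(-1)h_5(-1)\mathbf 1 +\tfrac{2}{3}e_{1,6}(-1)e_{2,3}(-1)e_{3,6}(-1)f_{5,6}(-1)\mathbf 1 -\tfrac{4}{15}e_{1,6}(-1)e_{2,4}(-1)e_{2,5}(-1)f_{2,4}(-1)\mathbf 1 \\ &-\tfrac{4}{3}e_{1,6}(-1)e_{2,4}(-1)e_{3,5}(-1)f_{3,4}(-1)\mathbf 1 -\tfrac{2}{3}e_{1,6}(-1)e_{2,4}(-1)e_{4,5}(-1)h_1(-1)\mathbf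 1 -\tfrac{2}{3}e_{1,6}(-1)e_{2,4}(-1)e_{4,5}(-1)h_2(-1)\mathbf 1 +\tfrac{2}{3}e_{1,6}(-1)e_{2,4}(-1)e_{4,5}(-1)h_3(-1)\mathbf 1 \\ &+\tfrac{2}{3}e_{1,6}(-1)e_{2,4}(-1)e_{4,5}(-1)h_4(-1)\mathbf 1 +\tfrac{2}{3}e_{1,6}(-1)e_{2,4}(-1)e_{4,5}(-1)h_5(-1)\mathbf 1 +\tfrac{2}{3}e_{1,6}(-1)e_{2,4}(-1)e_{4,6}(-1)f_{5,6}(-1)\mathbf 1 -\tfrac{4}{15}e_{1,6}(-1)e_{2,5}(-1)^2f_{2,5}(-1)\mathbf 1 \\ &-\tfrac{4}{15}e_{1,6}(-1)e_{2,5}(-1)e_{2,6}(-1)f_{2,6}(-1)\mathbf 1 +\tfrac{16}{15}e_{1,6}(-1)e_{2,5}(-1)e_{3,4}(-1)f_{3,4}(-1)\mathbf 1 -\tfrac{4}{15}e_{1,6}(-1)e_{2,5}(-1)e_{3,5}(-1)f_{3,5}(-1)\mathbf 1 -\tfrac{4}{15}e_{1,6}(-1)e_{2,5}(-1)e_{3,6}(-1)f_{3,6}(-1)\mathbf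 1 \\ &-\tfrac{4}{15}e_{1,6}(-1)e_{2,5}(-1)e_{4,5}(-1)f_{4,5}(-1)\mathbf 1 -\tfrac{4}{15}e_{1,6}(-1)e_{2,5}(-1)e_{4,6}(-1)f_{4,6}(-1)\mathbf 1 +\tfrac{2}{5}e_{1,6}(-1)e_{2,5}(-1)e_{5,6}(-1)f_{5,6}(-1)\mathbf 1 -\tfrac{2}{5}e_{1,6}(-1)e_{2,5}(-1)h_1(-1)h_2(-1)\mathbf 1 \\ &-\tfrac{2}{15}e_{1,6}(-1)e_{2,5}(-1)h_1(-1)h_3(-1)\mathbf 1 +\tfrac{2}{15}e_{1,6}(-1)e_{2,5}(-1)h_1(-1)h_4(-1)\mathbf 1 -\tfrac{4}{15}e_{1,6}(-1)e_{2,5}(-1)h_1(-1)h_5(-1)\mathbf 1 -\tfrac{2}{5}e_{1,6}(-1)e_{2,5}(-1)h_2(-1)^2\mathbf 1 \\ &-\tfrac{4}{15}e_{1,6}(-1)e_{2,5}(-1)h_2(-1)h_3(-1)\mathbf 1 +\tfrac{4}{15}e_{1,6}(-1)e_{2,5}(-1)h_2(-1)h_4(-1)\mathbf 1 +\tfrac{2}{15}e_{1,6}(-1)e_{2,5}(-1)h_2(-1)h_5(-1)\mathbf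 1 +\tfrac{2}{15}e_{1,6}(-1)e_{2,5}(-1)h_3(-1)^2\mathbf 1 \\ &-\tfrac{4}{15}e_{1,6}(-1)e_{2,5}(-1)h_3(-1)h_4(-1)\mathbf 1 -\tfrac{2}{15}e_{1,6}(-1)e_{2,5}(-1)h_3(-1)h_5(-1)\mathbf 1 -\tfrac{2}{5}e_{1,6}(-1)e_{2,5}(-1)h_4(-1)^2\mathbf 1 -\tfrac{2}{5}e_{1,6}(-1)e_{2,5}(-1)h_4(-1)h_5(-1)\mathbf 1 \\ &-\tfrac{2}{3}e_{1,6}(-1)e_{2,6}(-1)f_{5,6}(-1)h_1(-1)\mathbf 1. \end{aligned} $$ -/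

import Mathlib

noncomputable section

namespace AffineSl6

open scoped TensorProduct

/-! ### The simple Lie algebra `sl₆` -/

/-- The complex simple Lie algebra `𝔤 = sl₆` of traceless `6 × 6` matrices. -/
abbrev sl6 : Type := LieAlgebra.SpecialLinear.sl (Fin 6) ℂ

/-- For `1 ≤ i ≠ j ≤ 6`, the matrix unit with its `1` in row `i` and column `j`
(rows and columns are numbered from `1` to `6`). -/
def matrixUnit (i j : ℕ) : sl6 :=
  ⟨Matrix.of fun a b => if a.val + 1 = i ∧ b.val + 1 = j ∧ i ≠ j then 1 else 0, by
    simp only [LieAlgebra.SpecialLinear.sl, Matrix.traceLinearMap_apply, LinearMap.mem_ker,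
      Matrix.trace, ← LieSubalgebra.mem_toSubmodule]
    refine Finset.sum_eq_zero fun a _ => ?_
    simp only [Matrix.diag_apply, Matrix.of_apply]
    rw [if_neg]
    omega⟩

/-- The simple coroot `h_i = [e_{i,i+1}, f_{i,i+1}]`, `1 ≤ i ≤ 5`, i.e. the diagonal matrix with
entry `1` in position `i` and entry `-1` in position `i + 1`. -/
def coroot (i : ℕ) : sl6 := ⁅matrixUnit i (i + 1), matrixUnit (i + 1) i⁆

/-- The normalized invariant form `⟨x, y⟩ = tr (x y)` on `sl₆`; it is the multiple of the Killing
form for which `⟨θ, θ⟩ = 2`, where `θ` is the highest root. -/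
def form : LinearMap.BilinForm ℂ sl6 :=
  LinearMap.mk₂ ℂ (fun x y => Matrix.trace (x.1 * y.1))
    (fun x x' y => by simp [add_mul])
    (fun c x y => by simp)
    (fun x y y' => by simp [mul_add])
    (fun c x y => by simp)

theorem form_apply (x y : sl6) : form x y = Matrix.trace (x.1 * y.1) := rfl

theorem form_symm : (-form).IsSymm :=
  ⟨fun x y => by simp [form_apply, Matrix.trace_mul_comm x.1 y.1]⟩

theorem form_invariant : (-form).lieInvariant sl6 := by
  intro x y z
  simp only [LinearMap.neg_apply, form_apply, LieAlgebra.SpecialLinear.sl_bracket, sub_mul,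
    mul_sub, Matrix.trace_sub]
  have h1 : Matrix.trace (x.1 * y.1 * z.1) = Matrix.trace (y.1 * (z.1 * x.1)) := by
    rw [Matrix.mul_assoc, Matrix.trace_mul_comm, Matrix.mul_assoc]
  rw [h1, Matrix.mul_assoc y.1 x.1 z.1]
  ring

/-! ### The affine Lie algebra -/

/-- The cocycle `(x ⊗ t^m, y ⊗ t^n) ↦ m δ_{m+n,0} ⟨x, y⟩` on the loop algebra. (Mathlib's cocycle
attached to a form `Φ` is `n δ_{m+n,0} Φ(x, y)`, hence the sign.) -/
def cocycle := LieAlgebra.LoopAlgebra.twoCocycleOfBilinear ℂ ℤ sl6 (-form) form_invariant form_symm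

/-- The affine Lie algebra `ĝ = 𝔤 ⊗ ℂ[t, t⁻¹] ⊕ ℂ K` of `𝔤 = sl₆`. -/
abbrev Affine : Type := LieAlgebra.ofTwoCocycle cocycle

/-- The element `x ⊗ t^n` of `ĝ`. -/
def loop (n : ℤ) (x : sl6) : Affine :=
  LieAlgebra.ofProd cocycle (AddMonoidAlgebra.single n 1 ⊗ₜ[ℂ] x, 0)

/-- The central element `K` of `ĝ`. -/
def central : Affine :=
  LieAlgebra.ofProd cocycle (0, (TrivialLieModule.equiv ℂ (LieAlgebra.loopAlgebra ℂ ℤ sl6) ℂ).symm 1)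

open LieAlgebra.LoopAlgebra in
theorem lie_loop (m n : ℤ) (x y : sl6) :
    ⁅loop m x, loop n y⁆ =
      loop (m + n) ⁅x, y⁆ + (if m + n = 0 then (m : ℂ) * form x y else 0) • central := by
  have h : residuePairing ℂ ℤ sl6 (-form) (AddMonoidAlgebra.single m 1 ⊗ₜ[ℂ] x)
      (AddMonoidAlgebra.single n 1 ⊗ₜ[ℂ] y) = if m + n = 0 then (m : ℂ) * form x y else 0 := by
    rw [residuePairing_apply_apply, toFinsupp_single_tmul, toFinsupp_single_tmul,
      Finsupp.sum_single_index (by simp)]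
    by_cases hmn : m + n = 0
    · obtain rfl : n = -m := by omega
      simp
    · rw [Finsupp.single_eq_of_ne (by omega), if_neg hmn]
      simp
  rw [LieAlgebra.bracket_ofTwoCocycle]
  simp only [loop, central, ← LieAlgebra.of_smul, ← LieAlgebra.of_add]
  refine Equiv.congr_arg (Prod.ext ?_ ?_)
  · simp only [Equiv.symm_apply_apply, Prod.fst_add, Prod.smul_fst, smul_zero, add_zero]
    rw [LieAlgebra.ExtendScalars.bracket_tmul, AddMonoidAlgebra.single_mul_single, one_mul]
  · rw [← h]
    simp only [Equiv.symm_apply_apply, lie_zero, sub_zero, add_zero, Prod.snd_add, zero_add,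
      Prod.smul_snd, ← map_smul, smul_eq_mul, mul_one]
    rfl

theorem lie_central (a : Affine) : ⁅central, a⁆ = 0 := by
  refine (LieAlgebra.bracket_ofTwoCocycle _ _).trans
    (Equiv.congr_arg (f := LieAlgebra.ofProd cocycle) (x' := 0) (Prod.ext ?_ ?_))
  · simp [central]
  · simp only [central, Equiv.symm_apply_apply, map_zero, LinearMap.zero_apply, zero_add, trivial_lie_zero,
      sub_zero, Prod.snd_zero]

theorem affine_induction {p : Affine → Prop} (hl : ∀ n x, p (loop n x)) (hc : ∀ c : ℂ, p (c • central))
    (ha : ∀ a b, p a → p b → p (a + b)) (a : Affine) : p a := by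
  have h0 : p 0 := by simpa using hc 0
  have h1 (z : LieAlgebra.loopAlgebra ℂ ℤ sl6) : p (LieAlgebra.ofProd cocycle (z, 0)) := by
    induction z using TensorProduct.induction_on with
    | zero => exact h0
    | tmul f x =>
      induction f using AddMonoidAlgebra.induction_linear with
      | zero => rw [TensorProduct.zero_tmul]; exact h0
      | add f g hf hg => simpa [TensorProduct.add_tmul, ← LieAlgebra.of_add] using ha _ _ hf hg
      | single n c =>
        have : (AddMonoidAlgebra.single n c : AddMonoidAlgebra ℂ ℤ) ⊗ₜ[ℂ] x =
            AddMonoidAlgebra.single n 1 ⊗ₜ[ℂ] (c • x) := by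
          rw [← TensorProduct.smul_tmul, AddMonoidAlgebra.smul_single, smul_eq_mul, mul_one]
        rw [this]
        exact hl n (c • x)
    | add z w hz hw => simpa [← LieAlgebra.of_add] using ha _ _ hz hw
  obtain ⟨z, c⟩ := a
  have h2 := ha _ _ (h1 z) (hc (TrivialLieModule.equiv ℂ (LieAlgebra.loopAlgebra ℂ ℤ sl6) ℂ c))
  have h3 : LieAlgebra.ofProd cocycle (z, 0) +
      (TrivialLieModule.equiv ℂ (LieAlgebra.loopAlgebra ℂ ℤ sl6) ℂ c) • central =
      LieAlgebra.ofProd cocycle (z, c) := by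
    rw [central, ← LieAlgebra.of_smul, ← LieAlgebra.of_add]
    refine Equiv.congr_arg (Prod.ext (by simp) ?_)
    simp [← map_smul]
  rw [h3] at h2
  exact h2

/-- The operator `t d/dt` on Laurent polynomials. -/
def eulerLaurent : AddMonoidAlgebra ℂ ℤ →ₗ[ℂ] AddMonoidAlgebra ℂ ℤ :=
  (AddMonoidAlgebra.basis ℤ ℂ).constr ℂ fun n => (n : ℂ) • AddMonoidAlgebra.single n 1

/-- The degree derivation `d = t d/dt` of `ĝ`: `d (x ⊗ t^n) = n x ⊗ t^n` and `d K = 0`. -/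
def degreeDer : Affine →ₗ[ℂ] Affine where
  toFun a := LieAlgebra.ofProd cocycle
    (eulerLaurent.rTensor sl6 ((LieAlgebra.ofProd cocycle).symm a).1, 0)
  map_add' a b := by simp [← LieAlgebra.of_add]
  map_smul' c a := by simp [← LieAlgebra.of_smul]

theorem degreeDer_loop (n : ℤ) (x : sl6) : degreeDer (loop n x) = (n : ℂ) • loop n x := by
  have h : eulerLaurent (AddMonoidAlgebra.single n 1) = (n : ℂ) • AddMonoidAlgebra.single n 1 := by
    have := (AddMonoidAlgebra.basis ℤ ℂ).constr_basis ℂ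
      (fun n : ℤ => (n : ℂ) • (AddMonoidAlgebra.single n 1 : AddMonoidAlgebra ℂ ℤ)) n
    rwa [AddMonoidAlgebra.basis_apply] at this
  simp only [loop, ← LieAlgebra.of_smul]
  refine Equiv.congr_arg (Prod.ext ?_ ?_)
  · simp only [Equiv.symm_apply_apply, LinearMap.rTensor_tmul, h, TensorProduct.smul_tmul',
      Prod.smul_fst]
  · simp

theorem degreeDer_central : degreeDer central = 0 := by
  rw [← LieAlgebra.of_zero]
  refine Equiv.congr_arg (Prod.ext ?_ ?_) <;> simp [central]

theorem degreeDer_lie (a b : Affine) :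
    degreeDer ⁅a, b⁆ = ⁅degreeDer a, b⁆ + ⁅a, degreeDer b⁆ := by
  have hc (a : Affine) : ⁅a, central⁆ = 0 := by rw [← lie_skew, lie_central, neg_zero]
  induction a using affine_induction with
  | hc c => simp [lie_central, degreeDer_central]
  | ha a a' h h' => simp only [add_lie, map_add, h, h']; abel
  | hl m x =>
    induction b using affine_induction with
    | hc c => simp [hc, degreeDer_central]
    | ha b b' h h' => simp only [lie_add, map_add, h, h']; abel
    | hl n y =>
      simp only [lie_loop, map_add, map_smul, degreeDer_loop, degreeDer_central, smul_zero,
        add_zero, smul_lie, lie_smul, ← add_smul]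
      by_cases hmn : m + n = 0
      · have : (m : ℂ) + n = 0 := by exact_mod_cast hmn
        simp [hmn, this]
      · simp [hmn]

/-! ### The universal affine vertex algebra -/

/-- The universal enveloping algebra `U(ĝ)`. -/
abbrev U : Type := UniversalEnvelopingAlgebra ℂ Affine

/-- The mode `x(n)`, `x ∈ 𝔤`, i.e. the image of `x ⊗ t^n` in `U(ĝ)`. -/
def mode (x : sl6) (n : ℤ) : U := UniversalEnvelopingAlgebra.ι ℂ (loop n x)

/-- The image of `K` in `U(ĝ)`. -/
def centralU : U := UniversalEnvelopingAlgebra.ι ℂ central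

/-- The left ideal of `U(ĝ)` generated by `𝔤 ⊗ ℂ[t]` and `K - k`. -/
def vacuumIdeal (k : ℂ) : Submodule U U :=
  Submodule.span U
    ({u | ∃ (x : sl6) (n : ℤ), 0 ≤ n ∧ u = mode x n} ∪ {centralU - algebraMap ℂ U k})

/-- The universal affine vertex algebra `V^k(sl₆)` as a `ĝ`-module: the vacuum module
`U(ĝ) ⊗_{U(𝔤 ⊗ ℂ[t] ⊕ ℂ K)} ℂ_k`, on which `𝔤 ⊗ ℂ[t]` annihilates the vacuum and `K` acts as `k`. -/
abbrev V (k : ℂ) : Type := U ⧸ vacuumIdeal k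

/-- The vacuum vector `𝟏` of `V^k(sl₆)`. -/
def vac (k : ℂ) : V k := Submodule.Quotient.mk 1

attribute [local instance 100] LieRing.ofAssociativeRing

/-- The Lie algebra homomorphism `a ↦ a + ε d(a)` from `ĝ` to the dual numbers over `U(ĝ)`. -/
def degreeLift : Affine →ₗ⁅ℂ⁆ DualNumber U :=
  { toFun := fun a => TrivSqZeroExt.inl (UniversalEnvelopingAlgebra.ι ℂ a) +
      TrivSqZeroExt.inr (UniversalEnvelopingAlgebra.ι ℂ (degreeDer a))
    map_add' := fun a b => by ext <;> simp
    map_smul' := fun c a => by ext <;> simp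
    map_lie' := fun {a b} => by
      rw [degreeDer_lie]
      ext
      · simp [LieRing.of_associative_ring_bracket, -UniversalEnvelopingAlgebra.ι_apply]
      · simp only [LieRing.of_associative_ring_bracket, map_add, LieHom.map_lie,
          TrivSqZeroExt.snd_add, TrivSqZeroExt.snd_sub, TrivSqZeroExt.snd_mul,
          TrivSqZeroExt.snd_inl, TrivSqZeroExt.snd_inr, TrivSqZeroExt.fst_add,
          TrivSqZeroExt.fst_inl, TrivSqZeroExt.fst_inr, zero_add, add_zero, smul_eq_mul,
          op_smul_eq_mul]
        abel }

/-- The derivation of `U(ĝ)` which extends the derivation `d` of `ĝ`. -/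
def degreeU : U →ₗ[ℂ] U :=
  (TrivSqZeroExt.sndHom U U).restrictScalars ℂ ∘ₗ
    (UniversalEnvelopingAlgebra.lift ℂ degreeLift).toLinearMap

theorem degreeU_ι (a : Affine) :
    degreeU (UniversalEnvelopingAlgebra.ι ℂ a) =
      UniversalEnvelopingAlgebra.ι ℂ (degreeDer a) := by
  simp only [degreeU, LinearMap.comp_apply, AlgHom.toLinearMap_apply,
    UniversalEnvelopingAlgebra.lift_ι_apply, LinearMap.restrictScalars_apply]
  simp [degreeLift, -UniversalEnvelopingAlgebra.ι_apply]

theorem degreeLift_fst (u : U) :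
    (UniversalEnvelopingAlgebra.lift ℂ degreeLift u).fst = u := by
  have h : (TrivSqZeroExt.fstHom ℂ U U).comp (UniversalEnvelopingAlgebra.lift ℂ degreeLift) =
      AlgHom.id ℂ U := by
    ext a
    simp [degreeLift]
  exact DFunLike.congr_fun h u

theorem degreeU_mul (u w : U) : degreeU (u * w) = degreeU u * w + u * degreeU w := by
  simp only [degreeU, LinearMap.comp_apply, AlgHom.toLinearMap_apply, map_mul,
    LinearMap.restrictScalars_apply, TrivSqZeroExt.sndHom_apply, TrivSqZeroExt.snd_mul,
    degreeLift_fst, smul_eq_mul, op_smul_eq_mul]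
  rw [add_comm]

theorem degreeU_vacuumIdeal (k : ℂ) :
    (vacuumIdeal k).restrictScalars ℂ ≤ ((vacuumIdeal k).restrictScalars ℂ).comap degreeU := by
  intro u hu
  simp only [Submodule.mem_comap, Submodule.restrictScalars_mem] at hu ⊢
  induction hu using Submodule.span_induction with
  | zero => simp
  | add u w _ _ hu hw => simpa using add_mem hu hw
  | smul r u h hu =>
    rw [smul_eq_mul, degreeU_mul]
    exact add_mem (Submodule.smul_mem _ _ h) (Submodule.smul_mem _ _ hu)
  | mem u h =>
    rcases h with ⟨x, n, hn, rfl⟩ | rfl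
    · rw [mode, degreeU_ι, degreeDer_loop, map_smul]
      exact Submodule.smul_of_tower_mem _ _ (Submodule.subset_span (Or.inl ⟨x, n, hn, rfl⟩))
    · have h1 : degreeU 1 = 0 := by simp [degreeU]
      rw [map_sub, Algebra.algebraMap_eq_smul_one, map_smul, h1, centralU, degreeU_ι,
        degreeDer_central]
      simp

/-- The degree operator `d` on `V^k(sl₆)`, i.e. the linear operator with `d 𝟏 = 0` and
`[d, x(n)] = n x(n)`. -/
def degreeOp (k : ℂ) : V k →ₗ[ℂ] V k :=
  (Submodule.Quotient.restrictScalarsEquiv ℂ (vacuumIdeal k)).toLinearMap ∘ₗ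
    ((vacuumIdeal k).restrictScalars ℂ).mapQ _ degreeU (degreeU_vacuumIdeal k) ∘ₗ
    (Submodule.Quotient.restrictScalarsEquiv ℂ (vacuumIdeal k)).symm.toLinearMap

theorem degreeOp_vac (k : ℂ) : degreeOp k (vac k) = 0 := by
  have h1 : degreeU 1 = 0 := by simp [degreeU]
  have : degreeOp k (vac k) = Submodule.Quotient.mk (degreeU 1) := rfl
  rw [this, h1, Submodule.Quotient.mk_zero]

theorem degreeOp_mode (k : ℂ) (x : sl6) (n : ℤ) (w : V k) :
    degreeOp k (mode x n • w) = (n : ℂ) • mode x n • w + mode x n • degreeOp k w := by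
  obtain ⟨u, rfl⟩ := Submodule.Quotient.mk_surjective _ w
  have h (u : U) : degreeOp k (Submodule.Quotient.mk u) = Submodule.Quotient.mk (degreeU u) := rfl
  rw [← Submodule.Quotient.mk_smul, h, h, smul_eq_mul, degreeU_mul, mode, degreeU_ι,
    degreeDer_loop, map_smul, smul_mul_assoc]
  rfl

/-! ### Weights and singular vectors -/

/-- The Cartan subalgebra `𝔥` of `sl₆`: the traceless diagonal matrices. -/
def cartan : Submodule ℂ sl6 where
  carrier := {x | ∀ a b : Fin 6, a ≠ b → x.1 a b = 0}
  zero_mem' := by simp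
  add_mem' := by
    intro x y hx hy a b hab
    simp [hx a b hab, hy a b hab]
  smul_mem' := by
    intro c x hx a b hab
    simp [hx a b hab]

/-- The Cartan subalgebra `𝔥 ⊕ ℂ K ⊕ ℂ d` of the affine Kac-Moody algebra `ĝ ⊕ ℂ d`; the triple
`(x, a, b)` stands for `x + a K + b d`. -/
abbrev AffineCartan : Type := cartan × ℂ × ℂ

/-- The action of `𝔥 ⊕ ℂ K ⊕ ℂ d` on `V^k(sl₆)`. -/
def cartanAct (k : ℂ) (H : AffineCartan) (w : V k) : V k :=
  mode H.1.1 0 • w + H.2.1 • centralU • w + H.2.2 • degreeOp k w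

/-- The weight `Λ₀`: `Λ₀(K) = 1`, `Λ₀(𝔥) = Λ₀(d) = 0`. -/
def Lambda0 : Module.Dual ℂ AffineCartan :=
  LinearMap.fst ℂ ℂ ℂ ∘ₗ LinearMap.snd ℂ cartan (ℂ × ℂ)

/-- The imaginary root `δ`: `δ(d) = 1`, `δ(𝔥) = δ(K) = 0`. -/
def delta : Module.Dual ℂ AffineCartan :=
  LinearMap.snd ℂ ℂ ℂ ∘ₗ LinearMap.snd ℂ cartan (ℂ × ℂ)

/-- The fundamental weight `ω_i` of `sl₆`, `1 ≤ i ≤ 5`: it maps a traceless diagonal matrix to the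
sum of its first `i` diagonal entries, and `K` and `d` to zero. -/
def omega (i : ℕ) : Module.Dual ℂ AffineCartan where
  toFun H := ∑ a : Fin 6, if a.val < i then H.1.1.1 a a else 0
  map_add' H H' := by
    rw [← Finset.sum_add_distrib]
    refine Finset.sum_congr rfl fun a _ => ?_
    split_ifs <;> simp
  map_smul' c H := by
    rw [RingHom.id_apply, Finset.smul_sum]
    refine Finset.sum_congr rfl fun a _ => ?_
    split_ifs <;> simp

/-- The vector `w` of `V^k(sl₆)` has weight `μ`. -/
def HasWeight {k : ℂ} (w : V k) (μ : Module.Dual ℂ AffineCartan) : Prop :=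
  ∀ H : AffineCartan, cartanAct k H w = μ H • w

/-- A singular vector of `V^k(sl₆)`: a nonzero vector which is annihilated by `𝔫₊` (the strictly
upper triangular matrices, acting by zero modes) and by `𝔤 ⊗ t ℂ[t]`. -/
def IsSingular {k : ℂ} (w : V k) : Prop :=
  w ≠ 0 ∧ (∀ x : sl6, (∀ a b : Fin 6, b ≤ a → x.1 a b = 0) → mode x 0 • w = 0) ∧
    ∀ (x : sl6) (n : ℤ), 1 ≤ n → mode x n • w = 0

/-- The Sugawara operator
`L(0) = (2 (k + h^∨))⁻¹ ∑_i (x_i(0) y_i(0) + 2 ∑_{n ≥ 1} x_i(-n) y_i(n))`, `h^∨ = 6`, in terms of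
dual bases `x_i`, `y_i` of `𝔤`. On each vector only finitely many `n` contribute. -/
def sugawaraL0 (k : ℂ) {ι : Type} [Fintype ι] (x y : ι → sl6) (w : V k) : V k :=
  (2 * (k + 6))⁻¹ • ∑ i, (mode (x i) 0 • mode (y i) 0 • w +
    (2 : ℂ) • ∑ᶠ n : ℕ, mode (x i) (-(n + 1 : ℤ)) • mode (y i) (n + 1 : ℤ) • w)

/-- The vector `w` of `V^k(sl₆)` has conformal weight `c`, i.e. `L(0) w = c w`. (The operator `L(0)`
does not depend on the dual bases which are used to write it down.) -/
def HasConformalWeight {k : ℂ} (w : V k) (c : ℂ) : Prop :=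
  ∀ (ι : Type) [Fintype ι] [DecidableEq ι] (x : Module.Basis ι ℂ sl6) (y : ι → sl6),
    (∀ i j, form (x i) (y j) = if i = j then 1 else 0) → sugawaraL0 k x y w = c • w

/-! ### The explicit vector -/

/-- Symbols for the modes `e_{i,j}(n)`, `f_{i,j}(n)` (with `1 ≤ i < j ≤ 6`) and `h_i(n)` (with
`1 ≤ i ≤ 5`). -/
inductive Sym : Type
  | e (i j : ℕ) (n : ℤ) : Sym
  | f (i j : ℕ) (n : ℤ) : Sym
  | h (i : ℕ) (n : ℤ) : Sym

/-- The element of `U(ĝ)` denoted by a symbol: `e_{i,j}` is the matrix unit with entry `1` in row `i`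
and column `j`, `f_{i,j}` is its transpose, and `h_i` is the simple coroot. -/
def Sym.toU : Sym → U
  | .e i j n => mode (matrixUnit i j) n
  | .f i j n => mode (matrixUnit j i) n
  | .h i n => mode (coroot i) n

/-! The terms of the vector `v`: the entry `(c, [s₁, …, s_r])` stands for `c s₁ ⋯ s_r 𝟏`. -/

/-- The terms of `v` with two or three modes. -/
def vTerms1 : List (ℚ × List Sym) :=
  [(1, [.e 1 5 (-3), .e 2 6 (-1)]),
   (5/2, [.e 1 5 (-2), .e 2 6 (-2)]),
   (-1, [.e 1 6 (-3), .e 2 5 (-1)]),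
   (-5/2, [.e 1 6 (-2), .e 2 5 (-2)]),
   (-1, [.e 2 5 (-3), .e 1 6 (-1)]),
   (1, [.e 2 6 (-3), .e 1 5 (-1)]),
   (-7/5, [.e 1 5 (-2), .e 1 6 (-1), .f 1 2 (-1)]),
   (-5/3, [.e 1 5 (-2), .e 2 3 (-1), .e 3 6 (-1)]),
   (-5/3, [.e 1 5 (-2), .e 2 4 (-1), .e 4 6 (-1)]),
   (-5/3, [.e 1 5 (-2), .e 2 5 (-1), .e 5 6 (-1)]),
   (-1, [.e 1 5 (-2), .e 2 6 (-1), .h 2 (-1)]),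
   (-1/3, [.e 1 5 (-2), .e 2 6 (-1), .h 3 (-1)]),
   (1/3, [.e 1 5 (-2), .e 2 6 (-1), .h 4 (-1)]),
   (1, [.e 1 5 (-2), .e 2 6 (-1), .h 5 (-1)]),
   (-2/5, [.e 1 5 (-1), .e 2 6 (-1), .h 2 (-2)]),
   (2/15, [.e 1 5 (-1), .e 2 6 (-1), .h 3 (-2)]),
   (-2/5, [.e 1 5 (-1), .e 2 6 (-1), .h 4 (-2)]),
   (7/5, [.e 1 6 (-2), .e 1 5 (-1), .f 1 2 (-1)]),
   (5/3, [.e 1 6 (-2), .e 2 3 (-1), .e 3 5 (-1)]),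
   (5/3, [.e 1 6 (-2), .e 2 4 (-1), .e 4 5 (-1)]),
   (1, [.e 1 6 (-2), .e 2 5 (-1), .h 2 (-1)]),
   (1/3, [.e 1 6 (-2), .e 2 5 (-1), .h 3 (-1)]),
   (-1/3, [.e 1 6 (-2), .e 2 5 (-1), .h 4 (-1)]),
   (2/3, [.e 1 6 (-2), .e 2 5 (-1), .h 5 (-1)]),
   (5/3, [.e 1 6 (-2), .e 2 6 (-1), .f 5 6 (-1)]),
   (2/5, [.e 1 6 (-1), .e 2 5 (-1), .h 2 (-2)]),
   (-2/15, [.e 1 6 (-1), .e 2 5 (-1), .h 3 (-2)]),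
   (2/5, [.e 1 6 (-1), .e 2 5 (-1), .h 4 (-2)]),
   (-2/3, [.e 2 3 (-2), .e 1 5 (-1), .e 3 6 (-1)]),
   (2/3, [.e 2 3 (-2), .e 1 6 (-1), .e 3 5 (-1)]),
   (-2/3, [.e 2 4 (-2), .e 1 5 (-1), .e 4 6 (-1)]),
   (2/3, [.e 2 4 (-2), .e 1 6 (-1), .e 4 5 (-1)]),
   (1, [.e 2 5 (-2), .e 1 2 (-1), .e 2 6 (-1)]),
   (1, [.e 2 5 (-2), .e 1 3 (-1), .e 3 6 (-1)]),
   (1, [.e 2 5 (-2), .e 1 4 (-1), .e 4 6 (-1)]),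
   (1/3, [.e 2 5 (-2), .e 1 5 (-1), .e 5 6 (-1)]),
   (1, [.e 2 5 (-2), .e 1 6 (-1), .h 1 (-1)]),
   (1, [.e 2 5 (-2), .e 1 6 (-1), .h 2 (-1)]),
   (1/3, [.e 2 5 (-2), .e 1 6 (-1), .h 3 (-1)]),
   (-1/3, [.e 2 5 (-2), .e 1 6 (-1), .h 4 (-1)]),
   (-1/3, [.e 2 5 (-2), .e 1 6 (-1), .h 5 (-1)]),
   (-1, [.e 2 6 (-2), .e 1 2 (-1), .e 2 5 (-1)]),
   (-1, [.e 2 6 (-2), .e 1 3 (-1), .e 3 5 (-1)]),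
   (-1, [.e 2 6 (-2), .e 1 4 (-1), .e 4 5 (-1)]),
   (-1, [.e 2 6 (-2), .e 1 5 (-1), .h 1 (-1)]),
   (-1, [.e 2 6 (-2), .e 1 5 (-1), .h 2 (-1)]),
   (-1/3, [.e 2 6 (-2), .e 1 5 (-1), .h 3 (-1)]),
   (1/3, [.e 2 6 (-2), .e 1 5 (-1), .h 4 (-1)]),
   (-1/3, [.e 2 6 (-2), .e 1 6 (-1), .f 5 6 (-1)]),
   (-2/3, [.e 3 5 (-2), .e 1 3 (-1), .e 2 6 (-1)]),
   (2/3, [.e 3 5 (-2), .e 1 6 (-1), .e 2 3 (-1)]),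
   (2/3, [.e 3 6 (-2), .e 1 3 (-1), .e 2 5 (-1)]),
   (-2/3, [.e 3 6 (-2), .e 1 5 (-1), .e 2 3 (-1)]),
   (2/3, [.e 4 5 (-2), .e 1 4 (-1), .e 2 6 (-1)]),
   (-2/3, [.e 4 5 (-2), .e 1 6 (-1), .e 2 4 (-1)]),
   (-2/3, [.e 4 6 (-2), .e 1 4 (-1), .e 2 5 (-1)]),
   (2/3, [.e 4 6 (-2), .e 1 5 (-1), .e 2 4 (-1)])]

/-- The terms of `v` with four modes, part 1 of 3. -/
def vTerms2 : List (ℚ × List Sym) :=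
  [(-2/5, [.e 1 2 (-1), .e 1 5 (-1), .e 2 6 (-1), .f 1 2 (-1)]),
   (2/5, [.e 1 2 (-1), .e 1 6 (-1), .e 2 5 (-1), .f 1 2 (-1)]),
   (2/3, [.e 1 2 (-1), .e 2 3 (-1), .e 2 5 (-1), .e 3 6 (-1)]),
   (-2/3, [.e 1 2 (-1), .e 2 3 (-1), .e 2 6 (-1), .e 3 5 (-1)]),
   (2/3, [.e 1 2 (-1), .e 2 4 (-1), .e 2 5 (-1), .e 4 6 (-1)]),
   (-2/3, [.e 1 2 (-1), .e 2 4 (-1), .e 2 6 (-1), .e 4 5 (-1)]),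
   (2/3, [.e 1 2 (-1), .e 2 5 (-1), .e 2 5 (-1), .e 5 6 (-1)]),
   (-2/3, [.e 1 2 (-1), .e 2 5 (-1), .e 2 6 (-1), .h 5 (-1)]),
   (-2/3, [.e 1 2 (-1), .e 2 6 (-1), .e 2 6 (-1), .f 5 6 (-1)]),
   (4/15, [.e 1 3 (-1), .e 1 5 (-1), .e 2 6 (-1), .f 1 3 (-1)]),
   (-2/3, [.e 1 3 (-1), .e 1 5 (-1), .e 3 6 (-1), .f 1 2 (-1)]),
   (-4/15, [.e 1 3 (-1), .e 1 6 (-1), .e 2 5 (-1), .f 1 3 (-1)]),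
   (2/3, [.e 1 3 (-1), .e 1 6 (-1), .e 3 5 (-1), .f 1 2 (-1)]),
   (2, [.e 1 3 (-1), .e 2 4 (-1), .e 3 5 (-1), .e 4 6 (-1)]),
   (-2, [.e 1 3 (-1), .e 2 4 (-1), .e 3 6 (-1), .e 4 5 (-1)]),
   (-4/3, [.e 1 3 (-1), .e 2 5 (-1), .e 3 4 (-1), .e 4 6 (-1)]),
   (2/3, [.e 1 3 (-1), .e 2 5 (-1), .e 3 5 (-1), .e 5 6 (-1)]),
   (-2/3, [.e 1 3 (-1), .e 2 5 (-1), .e 3 6 (-1), .h 2 (-1)]),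
   (-2/3, [.e 1 3 (-1), .e 2 5 (-1), .e 3 6 (-1), .h 3 (-1)]),
   (2/3, [.e 1 3 (-1), .e 2 5 (-1), .e 3 6 (-1), .h 4 (-1)]),
   (4/3, [.e 1 3 (-1), .e 2 6 (-1), .e 3 4 (-1), .e 4 5 (-1)]),
   (2/3, [.e 1 3 (-1), .e 2 6 (-1), .e 3 5 (-1), .h 2 (-1)]),
   (2/3, [.e 1 3 (-1), .e 2 6 (-1), .e 3 5 (-1), .h 3 (-1)]),
   (-2/3, [.e 1 3 (-1), .e 2 6 (-1), .e 3 5 (-1), .h 4 (-1)]),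
   (-2/3, [.e 1 3 (-1), .e 2 6 (-1), .e 3 5 (-1), .h 5 (-1)]),
   (-2/3, [.e 1 3 (-1), .e 2 6 (-1), .e 3 6 (-1), .f 5 6 (-1)]),
   (4/15, [.e 1 4 (-1), .e 1 5 (-1), .e 2 6 (-1), .f 1 4 (-1)]),
   (-2/3, [.e 1 4 (-1), .e 1 5 (-1), .e 4 6 (-1), .f 1 2 (-1)]),
   (-4/15, [.e 1 4 (-1), .e 1 6 (-1), .e 2 5 (-1), .f 1 4 (-1)]),
   (2/3, [.e 1 4 (-1), .e 1 6 (-1), .e 4 5 (-1), .f 1 2 (-1)]),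
   (-2, [.e 1 4 (-1), .e 2 3 (-1), .e 3 5 (-1), .e 4 6 (-1)]),
   (2, [.e 1 4 (-1), .e 2 3 (-1), .e 3 6 (-1), .e 4 5 (-1)]),
   (-4/3, [.e 1 4 (-1), .e 2 5 (-1), .e 3 6 (-1), .f 3 4 (-1)]),
   (2/3, [.e 1 4 (-1), .e 2 5 (-1), .e 4 5 (-1), .e 5 6 (-1)]),
   (-2/3, [.e 1 4 (-1), .e 2 5 (-1), .e 4 6 (-1), .h 2 (-1)]),
   (2/3, [.e 1 4 (-1), .e 2 5 (-1), .e 4 6 (-1), .h 3 (-1)]),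
   (2/3, [.e 1 4 (-1), .e 2 5 (-1), .e 4 6 (-1), .h 4 (-1)]),
   (4/3, [.e 1 4 (-1), .e 2 6 (-1), .e 3 5 (-1), .f 3 4 (-1)]),
   (2/3, [.e 1 4 (-1), .e 2 6 (-1), .e 4 5 (-1), .h 2 (-1)]),
   (-2/3, [.e 1 4 (-1), .e 2 6 (-1), .e 4 5 (-1), .h 3 (-1)]),
   (-2/3, [.e 1 4 (-1), .e 2 6 (-1), .e 4 5 (-1), .h 4 (-1)]),
   (-2/3, [.e 1 4 (-1), .e 2 6 (-1), .e 4 5 (-1), .h 5 (-1)]),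
   (-2/3, [.e 1 4 (-1), .e 2 6 (-1), .e 4 6 (-1), .f 5 6 (-1)]),
   (4/15, [.e 1 5 (-1), .e 1 5 (-1), .e 2 6 (-1), .f 1 5 (-1)])]

/-- The terms of `v` with four modes, part 2 of 3. -/
def vTerms3 : List (ℚ × List Sym) :=
  [(-2/3, [.e 1 5 (-1), .e 1 5 (-1), .e 5 6 (-1), .f 1 2 (-1)]),
   (-4/15, [.e 1 5 (-1), .e 1 6 (-1), .e 2 5 (-1), .f 1 5 (-1)]),
   (4/15, [.e 1 5 (-1), .e 1 6 (-1), .e 2 6 (-1), .f 1 6 (-1)]),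
   (2/3, [.e 1 5 (-1), .e 1 6 (-1), .f 1 2 (-1), .h 5 (-1)]),
   (4/15, [.e 1 5 (-1), .e 2 3 (-1), .e 2 6 (-1), .f 2 3 (-1)]),
   (4/3, [.e 1 5 (-1), .e 2 3 (-1), .e 3 4 (-1), .e 4 6 (-1)]),
   (-2/3, [.e 1 5 (-1), .e 2 3 (-1), .e 3 5 (-1), .e 5 6 (-1)]),
   (2/3, [.e 1 5 (-1), .e 2 3 (-1), .e 3 6 (-1), .h 1 (-1)]),
   (2/3, [.e 1 5 (-1), .e 2 3 (-1), .e 3 6 (-1), .h 2 (-1)]),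
   (2/3, [.e 1 5 (-1), .e 2 3 (-1), .e 3 6 (-1), .h 3 (-1)]),
   (-2/3, [.e 1 5 (-1), .e 2 3 (-1), .e 3 6 (-1), .h 4 (-1)]),
   (4/15, [.e 1 5 (-1), .e 2 4 (-1), .e 2 6 (-1), .f 2 4 (-1)]),
   (4/3, [.e 1 5 (-1), .e 2 4 (-1), .e 3 6 (-1), .f 3 4 (-1)]),
   (-2/3, [.e 1 5 (-1), .e 2 4 (-1), .e 4 5 (-1), .e 5 6 (-1)]),
   (2/3, [.e 1 5 (-1), .e 2 4 (-1), .e 4 6 (-1), .h 1 (-1)]),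
   (2/3, [.e 1 5 (-1), .e 2 4 (-1), .e 4 6 (-1), .h 2 (-1)]),
   (-2/3, [.e 1 5 (-1), .e 2 4 (-1), .e 4 6 (-1), .h 3 (-1)]),
   (-2/3, [.e 1 5 (-1), .e 2 4 (-1), .e 4 6 (-1), .h 4 (-1)]),
   (4/15, [.e 1 5 (-1), .e 2 5 (-1), .e 2 6 (-1), .f 2 5 (-1)]),
   (2/3, [.e 1 5 (-1), .e 2 5 (-1), .e 5 6 (-1), .h 1 (-1)]),
   (4/15, [.e 1 5 (-1), .e 2 6 (-1), .e 2 6 (-1), .f 2 6 (-1)]),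
   (-16/15, [.e 1 5 (-1), .e 2 6 (-1), .e 3 4 (-1), .f 3 4 (-1)]),
   (4/15, [.e 1 5 (-1), .e 2 6 (-1), .e 3 5 (-1), .f 3 5 (-1)]),
   (4/15, [.e 1 5 (-1), .e 2 6 (-1), .e 3 6 (-1), .f 3 6 (-1)]),
   (4/15, [.e 1 5 (-1), .e 2 6 (-1), .e 4 5 (-1), .f 4 5 (-1)]),
   (4/15, [.e 1 5 (-1), .e 2 6 (-1), .e 4 6 (-1), .f 4 6 (-1)]),
   (-2/5, [.e 1 5 (-1), .e 2 6 (-1), .e 5 6 (-1), .f 5 6 (-1)]),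
   (2/5, [.e 1 5 (-1), .e 2 6 (-1), .h 1 (-1), .h 2 (-1)]),
   (2/15, [.e 1 5 (-1), .e 2 6 (-1), .h 1 (-1), .h 3 (-1)]),
   (-2/15, [.e 1 5 (-1), .e 2 6 (-1), .h 1 (-1), .h 4 (-1)]),
   (-2/5, [.e 1 5 (-1), .e 2 6 (-1), .h 1 (-1), .h 5 (-1)]),
   (2/5, [.e 1 5 (-1), .e 2 6 (-1), .h 2 (-1), .h 2 (-1)]),
   (4/15, [.e 1 5 (-1), .e 2 6 (-1), .h 2 (-1), .h 3 (-1)]),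
   (-4/15, [.e 1 5 (-1), .e 2 6 (-1), .h 2 (-1), .h 4 (-1)]),
   (-2/15, [.e 1 5 (-1), .e 2 6 (-1), .h 2 (-1), .h 5 (-1)]),
   (-2/15, [.e 1 5 (-1), .e 2 6 (-1), .h 3 (-1), .h 3 (-1)]),
   (4/15, [.e 1 5 (-1), .e 2 6 (-1), .h 3 (-1), .h 4 (-1)]),
   (2/15, [.e 1 5 (-1), .e 2 6 (-1), .h 3 (-1), .h 5 (-1)]),
   (2/5, [.e 1 5 (-1), .e 2 6 (-1), .h 4 (-1), .h 4 (-1)]),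
   (2/5, [.e 1 5 (-1), .e 2 6 (-1), .h 4 (-1), .h 5 (-1)]),
   (-4/15, [.e 1 6 (-1), .e 1 6 (-1), .e 2 5 (-1), .f 1 6 (-1)]),
   (2/3, [.e 1 6 (-1), .e 1 6 (-1), .f 1 2 (-1), .f 5 6 (-1)]),
   (-4/15, [.e 1 6 (-1), .e 2 3 (-1), .e 2 5 (-1), .f 2 3 (-1)]),
   (-4/3, [.e 1 6 (-1), .e 2 3 (-1), .e 3 4 (-1), .e 4 5 (-1)])]

/-- The terms of `v` with four modes, part 3 of 3. -/
def vTerms4 : List (ℚ × List Sym) :=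
  [(-2/3, [.e 1 6 (-1), .e 2 3 (-1), .e 3 5 (-1), .h 1 (-1)]),
   (-2/3, [.e 1 6 (-1), .e 2 3 (-1), .e 3 5 (-1), .h 2 (-1)]),
   (-2/3, [.e 1 6 (-1), .e 2 3 (-1), .e 3 5 (-1), .h 3 (-1)]),
   (2/3, [.e 1 6 (-1), .e 2 3 (-1), .e 3 5 (-1), .h 4 (-1)]),
   (2/3, [.e 1 6 (-1), .e 2 3 (-1), .e 3 5 (-1), .h 5 (-1)]),
   (2/3, [.e 1 6 (-1), .e 2 3 (-1), .e 3 6 (-1), .f 5 6 (-1)]),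
   (-4/15, [.e 1 6 (-1), .e 2 4 (-1), .e 2 5 (-1), .f 2 4 (-1)]),
   (-4/3, [.e 1 6 (-1), .e 2 4 (-1), .e 3 5 (-1), .f 3 4 (-1)]),
   (-2/3, [.e 1 6 (-1), .e 2 4 (-1), .e 4 5 (-1), .h 1 (-1)]),
   (-2/3, [.e 1 6 (-1), .e 2 4 (-1), .e 4 5 (-1), .h 2 (-1)]),
   (2/3, [.e 1 6 (-1), .e 2 4 (-1), .e 4 5 (-1), .h 3 (-1)]),
   (2/3, [.e 1 6 (-1), .e 2 4 (-1), .e 4 5 (-1), .h 4 (-1)]),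
   (2/3, [.e 1 6 (-1), .e 2 4 (-1), .e 4 5 (-1), .h 5 (-1)]),
   (2/3, [.e 1 6 (-1), .e 2 4 (-1), .e 4 6 (-1), .f 5 6 (-1)]),
   (-4/15, [.e 1 6 (-1), .e 2 5 (-1), .e 2 5 (-1), .f 2 5 (-1)]),
   (-4/15, [.e 1 6 (-1), .e 2 5 (-1), .e 2 6 (-1), .f 2 6 (-1)]),
   (16/15, [.e 1 6 (-1), .e 2 5 (-1), .e 3 4 (-1), .f 3 4 (-1)]),
   (-4/15, [.e 1 6 (-1), .e 2 5 (-1), .e 3 5 (-1), .f 3 5 (-1)]),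
   (-4/15, [.e 1 6 (-1), .e 2 5 (-1), .e 3 6 (-1), .f 3 6 (-1)]),
   (-4/15, [.e 1 6 (-1), .e 2 5 (-1), .e 4 5 (-1), .f 4 5 (-1)]),
   (-4/15, [.e 1 6 (-1), .e 2 5 (-1), .e 4 6 (-1), .f 4 6 (-1)]),
   (2/5, [.e 1 6 (-1), .e 2 5 (-1), .e 5 6 (-1), .f 5 6 (-1)]),
   (-2/5, [.e 1 6 (-1), .e 2 5 (-1), .h 1 (-1), .h 2 (-1)]),
   (-2/15, [.e 1 6 (-1), .e 2 5 (-1), .h 1 (-1), .h 3 (-1)]),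
   (2/15, [.e 1 6 (-1), .e 2 5 (-1), .h 1 (-1), .h 4 (-1)]),
   (-4/15, [.e 1 6 (-1), .e 2 5 (-1), .h 1 (-1), .h 5 (-1)]),
   (-2/5, [.e 1 6 (-1), .e 2 5 (-1), .h 2 (-1), .h 2 (-1)]),
   (-4/15, [.e 1 6 (-1), .e 2 5 (-1), .h 2 (-1), .h 3 (-1)]),
   (4/15, [.e 1 6 (-1), .e 2 5 (-1), .h 2 (-1), .h 4 (-1)]),
   (2/15, [.e 1 6 (-1), .e 2 5 (-1), .h 2 (-1), .h 5 (-1)]),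
   (2/15, [.e 1 6 (-1), .e 2 5 (-1), .h 3 (-1), .h 3 (-1)]),
   (-4/15, [.e 1 6 (-1), .e 2 5 (-1), .h 3 (-1), .h 4 (-1)]),
   (-2/15, [.e 1 6 (-1), .e 2 5 (-1), .h 3 (-1), .h 5 (-1)]),
   (-2/5, [.e 1 6 (-1), .e 2 5 (-1), .h 4 (-1), .h 4 (-1)]),
   (-2/5, [.e 1 6 (-1), .e 2 5 (-1), .h 4 (-1), .h 5 (-1)]),
   (-2/3, [.e 1 6 (-1), .e 2 6 (-1), .f 5 6 (-1), .h 1 (-1)])]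

/-- All the terms of `v`. -/
def vTerms : List (ℚ × List Sym) :=
  vTerms1 ++ vTerms2 ++ vTerms3 ++ vTerms4

/-- The explicit vector `v` in `V^{-7/2}(sl₆)`. -/
def v : V (-7 / 2) :=
  (vTerms.map fun t => (t.1 : ℂ) • (t.2.map Sym.toU).prod • vac (-7 / 2)).sum

end AffineSl6

end

/-! Singularity reduces to six finite computations. The modes e_{i,i+1}(0) and f_{1,6}(1) generate
the Lie algebra n_+ ⊕ t g[t]. Brackets of simple root vectors give n_+ (`upper_mem_annihilator`),
n_+ carries the lowest root vector f_{1,6} through all of sl_6 (`annihilator_one`), and [sl_6, sl_6]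
= sl_6 raises the degree (`annihilator_pos`). To see that the six modes kill v, words in modes of
traceless matrix units are sorted by the commutation relations with integer coefficients, and the
kernel checks that everything cancels (`isZero_actWords`). The soundness statement
`evalPoly_actWords` turns this into an identity in the vacuum module. Neither independence of the
sorted words nor completeness of the sorting is needed: formal cancellation suffices.

That v is nonzero needs a linear functional on V^k, which is obtained from geometry instead of a PBW
basis. Consider matrix loops g = 1 + X₀t⁻¹ + X₁t⁻² + ⋯, thought of as the big cell of the loop group
modulo loops regular in t. Left translation by a loop X reads Xg = g(g⁻¹Xg); dropping the part of
g⁻¹Xg with nonnegative powers of t leaves a vector field on the cell. These fields represent the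
loop algebra with the opposite bracket (`field_lie`). Adding k times the function -res tr((t dg/dt)
g⁻¹X) produces the cocycle (`field_charge_sub`), so the polynomial functions form a right module for
U(ĝ) at level k (`actFun_lie`). Acting on a function and evaluating at g = 1 gives a functional that
vanishes on the vacuum ideal (`evalAct_vacuumIdeal`). Negative modes act on the entries of X₀ by
translations, so on words in such modes the functional of a product of these entries is a
combinatorial sum (`evalAct_coordProd`). The product of the entries (1,3), (2,4), (3,5), (4,6) gives
v the value 2 (`pairing_vTerms`).

For the weight, all terms of v have the same one. For the conformal weight, positive modes kill v,
so L(0) reduces to the Casimir operator divided by 2(k + 6) = 5; the Casimir eigenvalue is 20 by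
n_+-invariance and the weight. -/

noncomputable section

namespace AffineSl6

open scoped TensorProduct

attribute [local instance 100] LieRing.ofAssociativeRing

/-! ### Coefficientwise operators on Laurent series -/

section Coefficientwise

variable {B : Type*} [Ring B]

/-- The additive operator on Laurent series which applies `θ n` to the `n`-th coefficient. -/
def coeffwise (θ : ℤ → B →+ B) : HahnSeries ℤ B →+ HahnSeries ℤ B where
  toFun x :=
    { coeff := fun n => θ n (x.coeff n)
      isPWO_support' := x.isPWO_support.mono fun n hn => by
        rw [HahnSeries.mem_support]
        intro h
        exact hn (by simp [h]) }
  map_zero' := by ext; simp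
  map_add' x y := by ext; simp

@[simp]
theorem coeff_coeffwise (θ : ℤ → B →+ B) (x : HahnSeries ℤ B) (n : ℤ) :
    (coeffwise θ x).coeff n = θ n (x.coeff n) := rfl

/-- A Leibniz rule graded by the order passes from coefficients to series. It covers both operators
used below: multiplication of the coefficient of order n by -n, and an ordinary derivation applied
to matrix entries. -/
theorem coeffwise_mul {θ : ℤ → B →+ B}
    (hθ : ∀ i j a b, θ (i + j) (a * b) = θ i a * b + a * θ j b) (x y : HahnSeries ℤ B) :
    coeffwise θ (x * y) = coeffwise θ x * y + x * coeffwise θ y := by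
  have hs (z : HahnSeries ℤ B) : (coeffwise θ z).support ⊆ z.support := fun n hn => by
    rw [HahnSeries.mem_support]
    intro h
    exact hn (by simp [h])
  ext n
  -- The support may shrink under `coeffwise θ`, so all three products are summed over the
  -- antidiagonal of the supports of `x` and `y`.
  rw [coeff_coeffwise, HahnSeries.coeff_add, HahnSeries.coeff_mul,
    HahnSeries.coeff_mul_left' x.isPWO_support (hs x),
    HahnSeries.coeff_mul_right' y.isPWO_support (hs y), map_sum, ← Finset.sum_add_distrib]
  refine Finset.sum_congr rfl fun ij h => ?_
  rw [← (Finset.mem_antidiagonal.1 h).2.2, hθ]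
  rfl

theorem coeff_mul_eq_zero {x y : HahnSeries ℤ B} {n : ℤ}
    (h : ∀ i j, i + j = n → x.coeff i = 0 ∨ y.coeff j = 0) : (x * y).coeff n = 0 := by
  rw [HahnSeries.coeff_mul]
  refine Finset.sum_eq_zero fun ij hij => ?_
  rcases h _ _ (Finset.mem_antidiagonal.1 hij).2.2 with h | h <;> simp [h]

/-- The part of a Laurent series of order at least one. -/
def hi : HahnSeries ℤ B →+ HahnSeries ℤ B :=
  coeffwise fun n => if 1 ≤ n then AddMonoidHom.id B else 0

theorem coeff_hi (x : HahnSeries ℤ B) (n : ℤ) : (hi x).coeff n = if 1 ≤ n then x.coeff n else 0 := by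
  rw [hi, coeff_coeffwise]
  split_ifs <;> rfl

theorem hi_eq_self {x : HahnSeries ℤ B} (h : ∀ n < 1, x.coeff n = 0) : hi x = x := by
  ext n
  rw [coeff_hi]
  split_ifs with hn
  · rfl
  · rw [h n (by omega)]

theorem hi_eq_zero {x : HahnSeries ℤ B} (h : ∀ n, 1 ≤ n → x.coeff n = 0) : hi x = 0 := by
  ext n
  rw [coeff_hi]
  split_ifs with hn
  · rw [h n hn]; rfl
  · rfl

/-- With s = t⁻¹, orders at least 1 are the negative powers of t. These series, and likewise those
with only orders at most 0 (`hi_lo_mul_lo`), are closed under multiplication; this splitting into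
two subalgebras underlies the whole construction. -/
theorem hi_hi_mul_hi (x y : HahnSeries ℤ B) : hi (hi x * hi y) = hi x * hi y := by
  refine hi_eq_self fun n hn => coeff_mul_eq_zero fun i j hij => ?_
  rw [coeff_hi, coeff_hi]
  by_cases hi : 1 ≤ i
  · right; rw [if_neg (by omega)]
  · left; rw [if_neg hi]

theorem hi_lo_mul_lo (x y : HahnSeries ℤ B) : hi ((x - hi x) * (y - hi y)) = 0 := by
  refine hi_eq_zero fun n hn => coeff_mul_eq_zero fun i j hij => ?_
  rw [HahnSeries.coeff_sub, HahnSeries.coeff_sub, coeff_hi, coeff_hi]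
  by_cases hi : 1 ≤ i
  · left; rw [if_pos hi, sub_self]
  · right; rw [if_pos (by omega), sub_self]

/-- The part of order at least one of a commutator. -/
theorem hi_commutator (x y : HahnSeries ℤ B) :
    hi (x * y - y * x) = hi x * hi y - hi y * hi x + hi (hi x * (y - hi y) - (y - hi y) * hi x)
      - hi (hi y * (x - hi x) - (x - hi x) * hi y) := by
  have h1 : x * y - y * x = (hi x * hi y - hi y * hi x) +
      (hi x * (y - hi y) - (y - hi y) * hi x) - (hi y * (x - hi x) - (x - hi x) * hi y) +
      ((x - hi x) * (y - hi y) - (y - hi y) * (x - hi x)) := by noncomm_ring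
  have h2 : hi ((x - hi x) * (y - hi y) - (y - hi y) * (x - hi x)) = 0 := by
    rw [map_sub, hi_lo_mul_lo, hi_lo_mul_lo, sub_zero]
  have h3 : hi (hi x * hi y - hi y * hi x) = hi x * hi y - hi y * hi x := by
    rw [map_sub, hi_hi_mul_hi, hi_hi_mul_hi]
  rw [h1, map_add hi _ ((x - hi x) * (y - hi y) - (y - hi y) * (x - hi x)), h2, add_zero,
    map_sub hi (_ + _), map_add hi (_ - _), h3]

/-- The Euler operator `t d/dt` on Laurent series in `s = t⁻¹`. -/
def euler : HahnSeries ℤ B →+ HahnSeries ℤ B :=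
  coeffwise fun n => zsmulAddGroupHom (-n)

theorem coeff_euler (x : HahnSeries ℤ B) (n : ℤ) : (euler x).coeff n = (-n) • x.coeff n := rfl

theorem euler_mul (x y : HahnSeries ℤ B) : euler (x * y) = euler x * y + x * euler y := by
  refine coeffwise_mul (fun i j a b => ?_) x y
  simp only [zsmulAddGroupHom_apply, neg_add, add_smul, smul_mul_assoc, mul_smul_comm]

theorem hi_euler (x : HahnSeries ℤ B) : hi (euler x) = euler (hi x) := by
  ext n
  rw [coeff_hi, coeff_euler, coeff_euler, coeff_hi]
  split_ifs <;> simp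

end Coefficientwise

/-! ### The residue pairing on loops of matrices -/

section Trace

variable {ι R : Type*} [Fintype ι] [CommRing R]

/-- The trace of the constant coefficient of a Laurent series of matrices. -/
def traceZero : HahnSeries ℤ (Matrix ι ι R) →+ R where
  toFun x := (x.coeff 0).trace
  map_zero' := by simp
  map_add' x y := by simp

theorem traceZero_apply (x : HahnSeries ℤ (Matrix ι ι R)) : traceZero x = (x.coeff 0).trace := rfl

theorem traceZero_mul_comm (x y : HahnSeries ℤ (Matrix ι ι R)) :
    traceZero (x * y) = traceZero (y * x) := by
  simp only [traceZero_apply, HahnSeries.coeff_mul, Matrix.trace_sum]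
  refine Finset.sum_nbij' Prod.swap Prod.swap ?_ ?_ (fun _ _ => rfl) (fun _ _ => rfl)
    fun ij _ => Matrix.trace_mul_comm _ _
  all_goals
    intro ij h
    rw [Finset.mem_antidiagonal] at h ⊢
    exact ⟨h.2.1, h.1, by rw [← h.2.2]; exact add_comm _ _⟩

variable [DecidableEq ι]

theorem traceZero_euler (x : HahnSeries ℤ (Matrix ι ι R)) : traceZero (euler x) = 0 := by
  simp [traceZero_apply, coeff_euler]

theorem traceZero_hi_mul_hi (x y : HahnSeries ℤ (Matrix ι ι R)) :
    traceZero (hi x * hi y) = 0 := by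
  rw [traceZero_apply, ← hi_hi_mul_hi, coeff_hi, if_neg (by norm_num), Matrix.trace_zero]

/-- Two orders at most 0 with sum 0 are both 0, and the Euler operator kills order 0. -/
theorem traceZero_euler_lo_mul_lo (x y : HahnSeries ℤ (Matrix ι ι R)) :
    traceZero (euler (x - hi x) * (y - hi y)) = 0 := by
  rw [traceZero_apply, coeff_mul_eq_zero, Matrix.trace_zero]
  intro i j hij
  rw [coeff_euler, HahnSeries.coeff_sub, HahnSeries.coeff_sub, coeff_hi, coeff_hi]
  rcases lt_trichotomy i 0 with h | h | h
  · right; rw [if_pos (by omega), sub_self]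
  · left; simp [h]
  · left; rw [if_pos (by omega), sub_self, smul_zero]

/-- The residue pairing of the difference between the positive and the nonnegative parts. -/
theorem traceZero_euler_hi_sub (x y : HahnSeries ℤ (Matrix ι ι R)) :
    traceZero (euler (hi x) * y) - traceZero (euler (hi y) * x) = traceZero (euler x * y) := by
  have h1 := traceZero_hi_mul_hi (euler x) y
  have h2 := traceZero_hi_mul_hi (euler y) x
  -- In the pairing of `euler x` with `y`, the low-low part vanishes by `h3`. In the low-high part,
  -- `h4` integrates by parts to move the Euler operator onto `hi y`, and `h2` allows the low part
  -- of `x` to be completed to `x`.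
  have h3 := traceZero_euler_lo_mul_lo x y
  have h4 := traceZero_euler ((x - hi x) * hi y)
  rw [hi_euler] at h1 h2
  rw [euler_mul, map_add, traceZero_mul_comm (x - hi x)] at h4
  simp only [map_sub, sub_mul, mul_sub] at h3 h4
  linear_combination -h2 - h3 - h4

variable {k : Type*} [CommRing k] [Algebra k R]

/-- A derivation of the ring of scalars, applied to all the entries of all the coefficients. -/
def mapDer (D : Derivation k R R) :
    HahnSeries ℤ (Matrix ι ι R) →+ HahnSeries ℤ (Matrix ι ι R) :=
  coeffwise fun _ => (D : R →ₗ[k] R).toAddMonoidHom.mapMatrix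

theorem coeff_mapDer (D : Derivation k R R) (x : HahnSeries ℤ (Matrix ι ι R)) (n : ℤ) (i j : ι) :
    (mapDer D x).coeff n i j = D (x.coeff n i j) := rfl

theorem mapDer_mul (D : Derivation k R R) (x y : HahnSeries ℤ (Matrix ι ι R)) :
    mapDer D (x * y) = mapDer D x * y + x * mapDer D y := by
  refine coeffwise_mul (fun _ _ a b => ?_) x y
  ext i j
  simp [Matrix.mul_apply, ← Finset.sum_add_distrib, mul_comm, add_comm]

theorem mapDer_hi (D : Derivation k R R) (x : HahnSeries ℤ (Matrix ι ι R)) :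
    mapDer D (hi x) = hi (mapDer D x) := by
  ext n i j
  rw [coeff_mapDer, coeff_hi, coeff_hi]
  split_ifs
  · rfl
  · simp

theorem mapDer_euler (D : Derivation k R R) (x : HahnSeries ℤ (Matrix ι ι R)) :
    mapDer D (euler x) = euler (mapDer D x) := by
  ext n i j
  rw [coeff_mapDer, coeff_euler, coeff_euler, Matrix.smul_apply, Matrix.smul_apply, coeff_mapDer]
  simp

theorem traceZero_mapDer (D : Derivation k R R) (x : HahnSeries ℤ (Matrix ι ι R)) :
    traceZero (mapDer D x) = D (traceZero x) := by
  simp only [traceZero_apply, Matrix.trace, Matrix.diag_apply, coeff_mapDer, map_sum]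

end Trace

/-! ### Identities in noncommutative rings -/

section Ring

variable {A : Type*} [Ring A]

theorem conj_mul_conj {g g' : A} (h : g * g' = 1) (a b : A) :
    g' * a * g * (g' * b * g) = g' * (a * b) * g := by
  calc _ = g' * a * (g * g') * b * g := by noncomm_ring
    _ = _ := by rw [h]; noncomm_ring

theorem conj_commutator {g g' : A} (h : g * g' = 1) (a b : A) :
    g' * (a * b - b * a) * g = g' * a * g * (g' * b * g) - g' * b * g * (g' * a * g) := by
  rw [conj_mul_conj h, conj_mul_conj h]
  noncomm_ring

/-- The Leibniz rule for g⁻¹yg: -(p * g') is the derivative of g' = g⁻¹, g * p that of g, and the 0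
that of the constant loop y. -/
theorem conj_leibniz (g g' p y : A) :
    (-(p * g') * y + g' * 0) * g + g' * y * (g * p) = g' * y * g * p - p * (g' * y * g) := by
  noncomm_ring

theorem commutator_sub_right (p q y : A) :
    y * p - p * y = q * p - p * q - (p * (y - q) - (y - q) * p) := by
  noncomm_ring

theorem mul_commutator_sub (g p q a b : A) :
    g * p * q + g * (q * p - p * q - a) - (g * q * p + g * (p * q - q * p - b)) =
      g * (q * p - p * q + b - a) := by
  noncomm_ring

theorem logDer_leibniz (g g' p y dg dp : A) :
    ((dg * p + g * dp) * g' + dg * -(p * g')) * y + dg * g' * 0 = g * (dp * g' * y) := by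
  noncomm_ring

/-- The factors g * g' are left standing on the right so that they can be replaced by 1 where this
is applied; no relation between g and g' is assumed here. -/
theorem conj_mul_conj_of_der (g g' x y dg dx : A) :
    ((-(g' * dg * g') * x + g' * dx) * g + g' * x * dg) * (g' * y * g) =
      g' * (-(dg * g') * x * (g * g') * y * g) + g' * (dx * (g * g') * y * g) +
        g' * (x * (dg * g') * y * g) := by
  noncomm_ring

end Ring

/-! ### Functions on the group of loops which are trivial at infinity -/

/-- The ring of functions on the group of matrices `1 + X₀ t⁻¹ + X₁ t⁻² + ⋯`. -/
abbrev Fun : Type := MvPolynomial (ℕ × Fin 6 × Fin 6) ℂ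

/-- Laurent series in `s = t⁻¹` whose coefficients are matrices of functions. -/
abbrev Loops : Type := HahnSeries ℤ (Matrix (Fin 6) (Fin 6) Fun)

/-- The coefficients of the generic group element. -/
def genericCoeff : ℕ → Matrix (Fin 6) (Fin 6) Fun
  | 0 => 1
  | n + 1 => Matrix.of fun i j => MvPolynomial.X (n, i, j)

/-- The generic group element `1 + X₀ t⁻¹ + X₁ t⁻² + ⋯`. -/
def generic : Loops := HahnSeries.ofPowerSeries ℤ _ (PowerSeries.mk genericCoeff)

/-- The inverse of the generic group element. -/
def genericInv : Loops :=
  HahnSeries.ofPowerSeries ℤ _ (PowerSeries.invOfUnit (PowerSeries.mk genericCoeff) 1)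

theorem constantCoeff_mk_genericCoeff :
    PowerSeries.constantCoeff (PowerSeries.mk genericCoeff) =
      ((1 : (Matrix (Fin 6) (Fin 6) Fun)ˣ) : Matrix (Fin 6) (Fin 6) Fun) := by
  simp [← PowerSeries.coeff_zero_eq_constantCoeff_apply, genericCoeff]

theorem generic_mul_inv : generic * genericInv = 1 := by
  rw [generic, genericInv, ← map_mul, PowerSeries.mul_invOfUnit _ _ constantCoeff_mk_genericCoeff,
    map_one]

theorem inv_mul_generic : genericInv * generic = 1 := by
  rw [generic, genericInv, ← map_mul, PowerSeries.invOfUnit_mul _ _ constantCoeff_mk_genericCoeff,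
    map_one]

theorem coeff_ofPowerSeries_neg {B : Type*} [Semiring B] (x : PowerSeries B) {n : ℤ} (hn : n < 0) :
    (HahnSeries.ofPowerSeries ℤ B x).coeff n = 0 := by
  rw [HahnSeries.ofPowerSeries_apply]
  refine HahnSeries.embDomain_of_notMem_range ?_
  rintro ⟨m, hm⟩
  have : (m : ℤ) = n := hm
  omega

theorem coeff_generic_neg {n : ℤ} (hn : n < 0) : generic.coeff n = 0 :=
  coeff_ofPowerSeries_neg _ hn

theorem coeff_genericInv_neg {n : ℤ} (hn : n < 0) : genericInv.coeff n = 0 :=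
  coeff_ofPowerSeries_neg _ hn

theorem coeff_generic_natCast (n : ℕ) : generic.coeff (n : ℤ) = genericCoeff n := by
  rw [generic, HahnSeries.ofPowerSeries_apply_coeff, PowerSeries.coeff_mk]

theorem coeff_generic_succ (n : ℕ) (i j : Fin 6) :
    generic.coeff ((n : ℤ) + 1) i j = MvPolynomial.X (n, i, j) := by
  have := coeff_generic_natCast (n + 1)
  push_cast at this
  rw [this]
  rfl

/-- The vector field by which a loop acts on the group. -/
def field (X : Loops) : Derivation ℂ Fun Fun :=
  MvPolynomial.mkDerivation ℂ fun p =>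
    (generic * hi (genericInv * X * generic)).coeff ((p.1 : ℤ) + 1) p.2.1 p.2.2

/-- The definition of `field` prescribes the velocity of the generic element only in orders at least
1, where the coordinates sit. In the other orders the generic element is constant, and the right
side vanishes because `hi` has order at least 1. -/
theorem mapDer_field (X : Loops) :
    mapDer (field X) generic = generic * hi (genericInv * X * generic) := by
  ext n : 2
  have h0 : ∀ n : ℤ, n ≤ 0 → (generic * hi (genericInv * X * generic)).coeff n = 0 := by
    refine fun n hn => coeff_mul_eq_zero fun a b hab => ?_
    rcases lt_or_ge a 0 with ha | ha
    · left; exact coeff_generic_neg ha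
    · right; rw [coeff_hi, if_neg (by omega)]
  rcases lt_trichotomy n 0 with h | rfl | h
  · rw [h0 n h.le]
    ext i j
    simp [coeff_mapDer, coeff_generic_neg h]
  · rw [h0 0 le_rfl]
    have := coeff_generic_natCast 0
    rw [Nat.cast_zero] at this
    ext i j
    rw [coeff_mapDer, this, genericCoeff, Matrix.one_apply]
    split_ifs <;> simp
  · obtain ⟨m, rfl⟩ : ∃ m : ℕ, n = (m : ℤ) + 1 := ⟨(n - 1).toNat, by omega⟩
    ext i j
    rw [coeff_mapDer, coeff_generic_succ, field, MvPolynomial.mkDerivation_X]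

/-- Every coordinate function is an entry of a coefficient of the generic element, so a vector field
is determined by the velocity of that element. -/
theorem derivation_eq_of_mapDer_generic {D E : Derivation ℂ Fun Fun}
    (h : mapDer D generic = mapDer E generic) : D = E := by
  refine MvPolynomial.derivation_ext fun p => ?_
  have := congrArg (fun x : Loops => x.coeff ((p.1 : ℤ) + 1) p.2.1 p.2.2) h
  simpa only [coeff_mapDer, coeff_generic_succ] using this

theorem mapDer_genericInv (X : Loops) :
    mapDer (field X) genericInv = -(hi (genericInv * X * generic) * genericInv) := by
  have h1 : mapDer (field X) (genericInv * generic) = 0 := by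
    rw [inv_mul_generic]
    have h := mapDer_mul (field X) (1 : Loops) 1
    simpa using h
  rw [mapDer_mul, mapDer_field, ← mul_assoc, inv_mul_generic, one_mul] at h1
  have h2 := congrArg (· * genericInv) h1
  simp only [add_mul, mul_assoc, generic_mul_inv, zero_mul, mul_one] at h2
  simp only [mul_assoc]
  exact eq_neg_of_add_eq_zero_left h2

/-- A loop whose coefficients are constant functions. -/
def IsConst (X : Loops) : Prop := ∀ D : Derivation ℂ Fun Fun, mapDer D X = 0

theorem mapDer_conj (X : Loops) {Y : Loops} (hY : IsConst Y) :
    mapDer (field X) (genericInv * Y * generic) =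
      genericInv * Y * generic * hi (genericInv * X * generic) -
        hi (genericInv * X * generic) * (genericInv * Y * generic) := by
  rw [mapDer_mul, mapDer_mul, mapDer_genericInv, mapDer_field, hY]
  exact conj_leibniz _ _ _ _

theorem mapDer_lie (D E : Derivation ℂ Fun Fun) (X : Loops) :
    mapDer ⁅D, E⁆ X = mapDer D (mapDer E X) - mapDer E (mapDer D X) := by
  ext n i j
  simp [coeff_mapDer, Derivation.commutator_apply]

/-- Both fields come from left translation, which explains the opposite order of the bracket. After
differentiating the velocity g · hi(g⁻¹Xg), the claim is an identity between x = g⁻¹Xg and y =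
g⁻¹Yg, supplied by `hi_commutator`. -/
theorem field_lie {X Y : Loops} (hX : IsConst X) (hY : IsConst Y) :
    ⁅field X, field Y⁆ = field (Y * X - X * Y) := by
  apply derivation_eq_of_mapDer_generic
  rw [mapDer_lie, mapDer_field, mapDer_field, mapDer_field, mapDer_mul, mapDer_mul, mapDer_field,
    mapDer_field, mapDer_hi, mapDer_hi, mapDer_conj _ hX, mapDer_conj _ hY]
  rw [conj_commutator generic_mul_inv]
  generalize genericInv * Y * generic = y
  generalize genericInv * X * generic = x
  rw [hi_commutator y x, commutator_sub_right (hi x) (hi y) y, commutator_sub_right (hi y) (hi x) x,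
    map_sub hi (hi y * hi x - hi x * hi y), map_sub hi (hi x * hi y - hi y * hi x),
    map_sub hi (hi y * hi x), map_sub hi (hi x * hi y), hi_hi_mul_hi, hi_hi_mul_hi]
  exact mul_commutator_sub _ _ _ _ _

/-- The multiplier which corrects the vector field of a loop at level one. -/
def charge (X : Loops) : Fun := -traceZero (euler generic * genericInv * X)

theorem field_charge (X : Loops) {Y : Loops} (hY : IsConst Y) :
    field X (charge Y) =
      -traceZero (euler (hi (genericInv * X * generic)) * (genericInv * Y * generic)) := by
  rw [charge, map_neg, ← traceZero_mapDer, mapDer_mul, mapDer_mul, mapDer_euler, mapDer_field,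
    mapDer_genericInv, hY, euler_mul]
  generalize hi (genericInv * X * generic) = p
  rw [logDer_leibniz, traceZero_mul_comm, mul_assoc, mul_assoc, mul_assoc]

/-- By `field_charge` the left side is a difference of residue pairings of the conjugates g⁻¹Xg and
g⁻¹Yg, which `traceZero_euler_hi_sub` evaluates. Undoing the conjugation leaves the central cocycle
plus the terms in which the Euler operator hits g, and those make up a charge. -/
theorem field_charge_sub {X Y : Loops} (hX : IsConst X) (hY : IsConst Y) :
    field X (charge Y) - field Y (charge X) =
      charge (Y * X - X * Y) - traceZero (euler X * Y) := by
  rw [field_charge _ hX, field_charge _ hY]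
  have h1 := traceZero_euler_hi_sub (genericInv * X * generic) (genericInv * Y * generic)
  -- Obtained by applying the Euler operator to g⁻¹g = 1.
  have h2 : euler genericInv = -(genericInv * euler generic * genericInv) := by
    have h := euler_mul genericInv generic
    have h0 : euler (1 : Loops) = 0 := by simpa using euler_mul (1 : Loops) 1
    rw [inv_mul_generic, h0] at h
    have h' := congrArg (· * genericInv) h
    simp only [add_mul, mul_assoc, generic_mul_inv, zero_mul, mul_one] at h'
    simp only [mul_assoc]
    exact eq_neg_of_add_eq_zero_left h'.symm
  -- The gauge transformation of the residue pairing; cyclicity of the trace collects the extra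
  -- terms as the pairing of `euler generic * genericInv` with YX - XY.
  have h3 : traceZero (euler (genericInv * X * generic) * (genericInv * Y * generic)) =
      traceZero (euler X * Y) - charge (Y * X - X * Y) := by
    rw [euler_mul, euler_mul, h2, conj_mul_conj_of_der, generic_mul_inv, map_add, map_add,
      traceZero_mul_comm, traceZero_mul_comm genericInv, traceZero_mul_comm genericInv, charge,
      mul_sub, map_sub]
    simp only [mul_one, mul_assoc, generic_mul_inv, neg_mul, map_neg]
    rw [traceZero_mul_comm X]
    simp only [mul_assoc]
    ring
  linear_combination -h1 - h3

/-! ### The action of the affine Lie algebra on functions -/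

section Scalars

variable (S A : Type*) [CommSemiring S] [Ring A] [Algebra S A]

theorem hahnSeries_smulCommClass : SMulCommClass S (HahnSeries ℤ A) (HahnSeries ℤ A) :=
  inferInstance

theorem hahnSeries_isScalarTower :
    IsScalarTower S (HahnSeries ℤ A) (HahnSeries ℤ A) := inferInstance

end Scalars

instance : SMulCommClass ℂ Loops Loops := hahnSeries_smulCommClass _ _

instance : IsScalarTower ℂ Loops Loops := hahnSeries_isScalarTower _ _

/-- A matrix in `sl₆` as a constant loop. -/
def constLoop : sl6 →ₗ[ℂ] Loops where
  toFun x := HahnSeries.single 0 (x.1.map MvPolynomial.C)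
  map_add' x y := by
    rw [← HahnSeries.single_add]
    congr 1
    ext1 i j
    simp
  map_smul' c x := by
    ext n i j
    simp only [HahnSeries.coeff_single, HahnSeries.coeff_smul, RingHom.id_apply, Matrix.smul_apply]
    split_ifs
    · simp [MvPolynomial.smul_eq_C_mul]
    · simp

/-- The Laurent polynomials as scalar loops, with `t = s⁻¹`. -/
def scalarLoop : AddMonoidAlgebra ℂ ℤ →ₗ[ℂ] Loops :=
  (AddMonoidAlgebra.basis ℤ ℂ).constr ℂ fun n => HahnSeries.single (-n) 1

theorem scalarLoop_single (n : ℤ) :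
    scalarLoop (AddMonoidAlgebra.single n 1) = HahnSeries.single (-n) 1 := by
  have := (AddMonoidAlgebra.basis ℤ ℂ).constr_basis ℂ
    (fun n : ℤ => (HahnSeries.single (-n) 1 : Loops)) n
  rwa [AddMonoidAlgebra.basis_apply] at this

/-- The projection of the affine Lie algebra to loops. -/
def toLoops : Affine →ₗ[ℂ] Loops where
  toFun a := LinearMap.mul' ℂ Loops
    (TensorProduct.map scalarLoop constLoop ((LieAlgebra.ofProd cocycle).symm a).1)
  map_add' a b := by simp
  map_smul' c a := by simp

theorem toLoops_loop (n : ℤ) (x : sl6) :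
    toLoops (loop n x) = HahnSeries.single (-n) (x.1.map MvPolynomial.C) := by
  simp only [toLoops, loop, LinearMap.coe_mk, AddHom.coe_mk, Equiv.symm_apply_apply,
    TensorProduct.map_tmul, LinearMap.mul'_apply, scalarLoop_single, constLoop,
    HahnSeries.single_mul_single, add_zero, one_mul]

theorem toLoops_central : toLoops central = 0 := by
  simp [toLoops, central]

/-- The coefficient of `K`. -/
def centralCoeff : Affine →ₗ[ℂ] ℂ where
  toFun a := (TrivialLieModule.equiv ℂ (LieAlgebra.loopAlgebra ℂ ℤ sl6) ℂ)
    ((LieAlgebra.ofProd cocycle).symm a).2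
  map_add' a b := by simp
  map_smul' c a := by simp

theorem centralCoeff_loop (n : ℤ) (x : sl6) : centralCoeff (loop n x) = 0 := by
  simp [centralCoeff, loop]

theorem centralCoeff_central : centralCoeff central = 1 := by
  simp [centralCoeff, central]

theorem isConst_toLoops (a : Affine) : IsConst (toLoops a) := by
  intro D
  induction a using affine_induction with
  | hl n x =>
    ext m i j
    rw [toLoops_loop, coeff_mapDer, HahnSeries.coeff_single]
    split_ifs <;> simp
  | hc c => simp [toLoops_central]
  | ha a b ha hb => rw [map_add, map_add, ha, hb, add_zero]

theorem toLoops_lie (a b : Affine) :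
    toLoops ⁅a, b⁆ = toLoops a * toLoops b - toLoops b * toLoops a := by
  have hc (a : Affine) : ⁅a, central⁆ = 0 := by rw [← lie_skew, lie_central, neg_zero]
  induction a using affine_induction with
  | hc c => simp [lie_central, toLoops_central]
  | ha a a' h h' => simp only [add_lie, map_add, h, h', add_mul, mul_add]; abel
  | hl m x =>
    induction b using affine_induction with
    | hc c => simp [hc, toLoops_central]
    | ha b b' h h' => simp only [lie_add, map_add, h, h', add_mul, mul_add]; abel
    | hl n y =>
      rw [lie_loop, map_add, map_smul, toLoops_central, smul_zero, add_zero, toLoops_loop,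
        toLoops_loop, toLoops_loop, HahnSeries.single_mul_single, HahnSeries.single_mul_single,
        ← neg_add, ← neg_add, add_comm n m, ← HahnSeries.single_sub]
      rw [← Matrix.map_mul, ← Matrix.map_mul, LieAlgebra.SpecialLinear.sl_bracket, Matrix.map_sub]
      exact map_sub _

/-- This identifies the cocycle defining `Affine` with the residue in `field_charge_sub`. The signs
agree because x(m) becomes a loop of order -m in s, on which the Euler operator is multiplication by
m. -/
theorem C_centralCoeff_lie (a b : Affine) :
    MvPolynomial.C (centralCoeff ⁅a, b⁆) = traceZero (euler (toLoops a) * toLoops b) := by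
  have hc (a : Affine) : ⁅a, central⁆ = 0 := by rw [← lie_skew, lie_central, neg_zero]
  induction a using affine_induction with
  | hc c => simp [lie_central, toLoops_central]
  | ha a a' h h' => simp only [add_lie, map_add, h, h', add_mul]
  | hl m x =>
    induction b using affine_induction with
    | hc c => simp [hc, toLoops_central]
    | ha b b' h h' => simp only [lie_add, map_add, h, h', mul_add]
    | hl n y =>
      have he : euler (toLoops (loop m x)) =
          HahnSeries.single (-m) (m • x.1.map (MvPolynomial.C : ℂ →+* Fun)) := by
        ext k
        rw [coeff_euler, toLoops_loop, HahnSeries.coeff_single, HahnSeries.coeff_single]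
        split_ifs with h
        · rw [h, neg_neg]
        · simp
      rw [lie_loop, map_add, map_smul, centralCoeff_central, centralCoeff_loop, he, toLoops_loop,
        HahnSeries.single_mul_single, traceZero_apply, HahnSeries.coeff_single, form_apply]
      by_cases h : m + n = 0
      · rw [if_pos h, if_pos (by omega)]
        rw [smul_mul_assoc, ← Matrix.map_mul, Matrix.trace_smul, ← AddMonoidHom.map_trace]
        simp
      · rw [if_neg h, if_neg (by omega)]
        simp

theorem field_add (X Y : Loops) : field (X + Y) = field X + field Y := by
  apply derivation_eq_of_mapDer_generic
  ext n i j
  simp only [coeff_mapDer, Derivation.add_apply]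
  rw [← coeff_mapDer, ← coeff_mapDer, ← coeff_mapDer, mapDer_field, mapDer_field, mapDer_field,
    mul_add, add_mul, map_add, mul_add]
  rfl

theorem hi_smul (c : ℂ) (X : Loops) : hi (c • X) = c • hi X := by
  ext n
  rw [coeff_hi, HahnSeries.coeff_smul, HahnSeries.coeff_smul, coeff_hi]
  split_ifs
  · rfl
  · rw [smul_zero]

theorem field_smul (c : ℂ) (X : Loops) : field (c • X) = c • field X := by
  apply derivation_eq_of_mapDer_generic
  ext n i j
  simp only [coeff_mapDer, Derivation.smul_apply]
  rw [← coeff_mapDer, ← coeff_mapDer, mapDer_field, mapDer_field, mul_smul_comm, smul_mul_assoc,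
    hi_smul, mul_smul_comm]
  rfl

theorem charge_add (X Y : Loops) : charge (X + Y) = charge X + charge Y := by
  simp only [charge, mul_add, map_add]
  ring

theorem charge_smul (c : ℂ) (X : Loops) : charge (c • X) = c • charge X := by
  rw [charge, charge, mul_smul_comm, smul_neg]
  congr 1
  simp [traceZero_apply]

/-- The first order differential operator by which an element of `ĝ` acts on functions. -/
def actFun (k : ℂ) : Affine →ₗ[ℂ] Module.End ℂ Fun where
  toFun a := (field (toLoops a) : Fun →ₗ[ℂ] Fun) +
    LinearMap.mulLeft ℂ (k • (charge (toLoops a) + MvPolynomial.C (centralCoeff a)))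
  map_add' a b := by
    refine LinearMap.ext fun f => ?_
    simp only [map_add, field_add, charge_add, LinearMap.add_apply, LinearMap.mulLeft_apply,
      MvPolynomial.smul_eq_C_mul, Derivation.coe_add_linearMap]
    ring
  map_smul' c a := by
    refine LinearMap.ext fun f => ?_
    simp only [map_smul, field_smul, charge_smul, LinearMap.add_apply, LinearMap.mulLeft_apply,
      MvPolynomial.smul_eq_C_mul, Derivation.coe_smul_linearMap, LinearMap.smul_apply, smul_eq_mul,
      map_mul, RingHom.id_apply]
    ring

theorem actFun_apply (k : ℂ) (a : Affine) (f : Fun) :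
    actFun k a f = field (toLoops a) f +
      MvPolynomial.C k * (charge (toLoops a) + MvPolynomial.C (centralCoeff a)) * f := by
  simp only [actFun, LinearMap.coe_mk, AddHom.coe_mk, LinearMap.add_apply,
    LinearMap.mulLeft_apply, MvPolynomial.smul_eq_C_mul]
  rfl

/-- The vector field parts match by `field_lie` and the multipliers by `field_charge_sub`. The
bracket comes out reversed, so U(ĝ) acts on functions from the right. -/
theorem actFun_lie (k : ℂ) (a b : Affine) :
    actFun k ⁅a, b⁆ = actFun k b * actFun k a - actFun k a * actFun k b := by
  refine LinearMap.ext fun f => ?_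
  have h1 := field_lie (isConst_toLoops b) (isConst_toLoops a)
  have h2 := field_charge_sub (isConst_toLoops b) (isConst_toLoops a)
  have h3 := congrArg (fun D : Derivation ℂ Fun Fun => D f) h1
  have h4 := C_centralCoeff_lie a b
  have h5 : traceZero (euler (toLoops b) * toLoops a) =
      -traceZero (euler (toLoops a) * toLoops b) := by
    have := traceZero_euler (toLoops a * toLoops b)
    rw [euler_mul, map_add, traceZero_mul_comm (toLoops a)] at this
    linear_combination this
  rw [← toLoops_lie] at h2 h3
  rw [h5, ← h4] at h2
  simp only [Derivation.commutator_apply] at h3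
  simp only [LinearMap.sub_apply, Module.End.mul_apply, actFun_apply, map_add, Derivation.leibniz,
    smul_eq_mul, MvPolynomial.derivation_C, mul_zero, add_zero]
  linear_combination -h3 - MvPolynomial.C k * f * h2

/-- The right action of `U(ĝ)` on functions. -/
def rightAct (k : ℂ) : U →ₐ[ℂ] (Module.End ℂ Fun)ᵐᵒᵖ :=
  UniversalEnvelopingAlgebra.lift ℂ
    { toFun := fun a => MulOpposite.op (actFun k a)
      map_add' := fun a b => by rw [map_add, MulOpposite.op_add]
      map_smul' := fun c a => by rw [map_smul, MulOpposite.op_smul]; rfl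
      map_lie' := fun {a b} => by
        rw [actFun_lie, LieRing.of_associative_ring_bracket]
        rfl }

theorem rightAct_ι (k : ℂ) (a : Affine) :
    rightAct k (UniversalEnvelopingAlgebra.ι ℂ a) = MulOpposite.op (actFun k a) := by
  rw [rightAct, UniversalEnvelopingAlgebra.lift_ι_apply]
  rfl

/-- The value at the identity of the result of the right action of `U(ĝ)` on a function. -/
def evalAct (k : ℂ) (f : Fun) : U →ₗ[ℂ] ℂ where
  toFun u := MvPolynomial.eval 0 ((rightAct k u).unop f)
  map_add' u w := by simp
  map_smul' c u := by simp [MvPolynomial.smul_eq_C_mul]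

theorem evalAct_one (k : ℂ) (f : Fun) : evalAct k f 1 = MvPolynomial.eval 0 f := by
  simp only [evalAct, LinearMap.coe_mk, AddHom.coe_mk, map_one]
  rfl

/-- For a right action the leftmost factor acts first, which lets a word be evaluated letter by
letter from its head. -/
theorem evalAct_ι_mul (k : ℂ) (f : Fun) (a : Affine) (u : U) :
    evalAct k f (UniversalEnvelopingAlgebra.ι ℂ a * u) = evalAct k (actFun k a f) u := by
  simp only [evalAct, LinearMap.coe_mk, AddHom.coe_mk, map_mul, rightAct_ι]
  rfl

/-! ### Specialization at the identity of the group -/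

theorem hahnSeries_map_mul {B C : Type*} [Semiring B] [Semiring C] (f : B →+* C)
    (x y : HahnSeries ℤ B) : (x * y).map f = x.map f * y.map f :=
  HahnSeries.map_mul (f : B →ₙ+* C)

/-- The specialization of a loop of functions at the identity of the group. -/
def specialize (X : Loops) : HahnSeries ℤ (Matrix (Fin 6) (Fin 6) ℂ) :=
  X.map (MvPolynomial.eval (0 : ℕ × Fin 6 × Fin 6 → ℂ)).mapMatrix

theorem coeff_specialize (X : Loops) (n : ℤ) (i j : Fin 6) :
    (specialize X).coeff n i j = MvPolynomial.eval 0 (X.coeff n i j) := rfl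

theorem specialize_mul (X Y : Loops) : specialize (X * Y) = specialize X * specialize Y :=
  hahnSeries_map_mul _ X Y

theorem specialize_one : specialize 1 = 1 := by
  ext n i j
  rw [coeff_specialize, HahnSeries.coeff_one, HahnSeries.coeff_one]
  split_ifs
  · rw [Matrix.one_apply, Matrix.one_apply]
    split_ifs <;> simp
  · simp

theorem specialize_generic : specialize generic = 1 := by
  ext n i j
  rw [coeff_specialize, HahnSeries.coeff_one]
  rcases lt_trichotomy n 0 with h | rfl | h
  · rw [coeff_generic_neg h, if_neg h.ne]; simp
  · have := coeff_generic_natCast 0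
    rw [Nat.cast_zero] at this
    rw [this, if_pos rfl, genericCoeff, Matrix.one_apply, Matrix.one_apply]
    split_ifs <;> simp
  · obtain ⟨m, rfl⟩ : ∃ m : ℕ, n = (m : ℤ) + 1 := ⟨(n - 1).toNat, by omega⟩
    rw [coeff_generic_succ, if_neg h.ne']
    simp

theorem specialize_genericInv : specialize genericInv = 1 := by
  have := congrArg specialize generic_mul_inv
  rwa [specialize_mul, specialize_generic, specialize_one, one_mul] at this

theorem specialize_hi (X : Loops) : specialize (hi X) = hi (specialize X) := by
  ext n i j
  rw [coeff_specialize, coeff_hi, coeff_hi]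
  split_ifs
  · rfl
  · simp

theorem specialize_euler (X : Loops) : specialize (euler X) = euler (specialize X) := by
  ext n i j
  rw [coeff_specialize, coeff_euler, coeff_euler]
  simp [coeff_specialize]

/-- At g = 1 the Euler derivative of g is 0. -/
theorem eval_charge (X : Loops) : MvPolynomial.eval 0 (charge X) = 0 := by
  have h : MvPolynomial.eval 0 (charge X) =
      -traceZero (specialize (euler generic * genericInv * X)) := by
    simp [charge, traceZero_apply, Matrix.trace, coeff_specialize]
  have h0 : euler (1 : HahnSeries ℤ (Matrix (Fin 6) (Fin 6) ℂ)) = 0 := by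
    simpa using euler_mul (1 : HahnSeries ℤ (Matrix (Fin 6) (Fin 6) ℂ)) 1
  rw [h, specialize_mul, specialize_mul, specialize_euler, specialize_generic, h0]
  simp

/-- Loops regular in t fix the base point: at g = 1 the velocity is `hi X`, which is 0 when X has
order -n ≤ 0. -/
theorem eval_field_loop {n : ℤ} (hn : 0 ≤ n) (x : sl6) (f : Fun) :
    MvPolynomial.eval 0 (field (toLoops (loop n x)) f) = 0 := by
  have hX (p : ℕ × Fin 6 × Fin 6) :
      MvPolynomial.eval 0 (field (toLoops (loop n x)) (MvPolynomial.X p)) = 0 := by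
    rw [field, MvPolynomial.mkDerivation_X, ← coeff_specialize, specialize_mul, specialize_hi,
      specialize_mul, specialize_mul, specialize_genericInv, specialize_generic, one_mul, one_mul,
      mul_one, hi_eq_zero, HahnSeries.coeff_zero]
    · rfl
    · intro m hm
      ext i j
      rw [coeff_specialize, toLoops_loop, HahnSeries.coeff_single, if_neg (by omega)]
      simp
  induction f using MvPolynomial.induction_on with
  | C c => simp
  | add f g hf hg => rw [map_add, map_add, hf, hg, add_zero]
  | mul_X f p hf => 
    rw [Derivation.leibniz]
    simp only [smul_eq_mul, map_add, map_mul, hf, hX, mul_zero, add_zero]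

/-- Each function thus defines a functional on V^k. The function must vary in the induction, because
a left multiplier r of an ideal element is absorbed by letting r act on `f`. -/
theorem evalAct_vacuumIdeal {k : ℂ} {u : U} (hu : u ∈ vacuumIdeal k) (f : Fun) :
    evalAct k f u = 0 := by
  induction hu using Submodule.span_induction generalizing f with
  | zero => simp
  | add u w _ _ hu hw => rw [map_add, hu, hw, add_zero]
  | smul r u _ hu =>
    have : evalAct k f (r • u) = evalAct k ((rightAct k r).unop f) u := by
      simp [evalAct, smul_eq_mul]
    rw [this, hu]
  | mem u h =>
    rcases h with ⟨x, n, hn, rfl⟩ | rfl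
    · rw [← mul_one (mode x n), mode, evalAct_ι_mul, evalAct_one, actFun_apply, map_add,
        eval_field_loop hn, map_mul, map_mul, map_add, eval_charge, centralCoeff_loop]
      simp
    · have h1 : evalAct k f centralU = evalAct k f (centralU * 1) := by rw [mul_one]
      have h2 : field 0 = 0 := by simpa using field_add 0 0
      rw [map_sub, h1, centralU, evalAct_ι_mul, evalAct_one, actFun_apply, toLoops_central,
        centralCoeff_central, Algebra.algebraMap_eq_smul_one, map_smul, evalAct_one, h2]
      simp [charge]

/-- Loops of negative degree act on the first coordinates by translation. -/
theorem field_loop_neg {n : ℤ} (hn : n < 0) (x : sl6) (i j : Fin 6) :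
    field (toLoops (loop n x)) (MvPolynomial.X (0, i, j)) =
      MvPolynomial.C (if n = -1 then x.1 i j else 0) := by
  -- For n < 0 the conjugate already has order at least 1, so nothing is discarded and the field is
  -- the honest left translation g ↦ Xg.
  have h : hi (genericInv * toLoops (loop n x) * generic) =
      genericInv * toLoops (loop n x) * generic := by
    refine hi_eq_self fun m hm => coeff_mul_eq_zero fun a b hab => ?_
    rcases lt_or_ge b 0 with hb | hb
    · right; exact coeff_generic_neg hb
    left
    refine coeff_mul_eq_zero fun a' b' hab' => ?_
    rcases lt_or_ge a' 0 with ha | ha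
    · left; exact coeff_genericInv_neg ha
    right
    rw [toLoops_loop, HahnSeries.coeff_single, if_neg (by omega)]
  rw [field, MvPolynomial.mkDerivation_X, h, ← mul_assoc, ← mul_assoc, generic_mul_inv, one_mul,
    toLoops_loop, HahnSeries.coeff_single_mul]
  simp only [Nat.cast_zero, zero_add, sub_neg_eq_add]
  have := coeff_generic_natCast 0
  rw [Nat.cast_zero] at this
  by_cases h1 : n = -1
  · subst h1
    simp [this, genericCoeff]
  · rw [coeff_generic_neg (by omega), if_neg h1]
    simp

/-- The factor `euler generic * genericInv` has order at least 0 and the loop has order -n > 0, so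
the product has no constant term. -/
theorem charge_loop_neg {n : ℤ} (hn : n < 0) (x : sl6) : charge (toLoops (loop n x)) = 0 := by
  rw [charge, traceZero_apply, coeff_mul_eq_zero, Matrix.trace_zero, neg_zero]
  intro a b hab
  rcases lt_or_ge a 0 with ha | ha
  · left
    refine coeff_mul_eq_zero fun a' b' hab' => ?_
    rcases lt_or_ge a' 0 with ha' | ha'
    · left; rw [coeff_euler, coeff_generic_neg ha', smul_zero]
    · right; exact coeff_genericInv_neg (by omega)
  · right
    rw [toLoops_loop, HahnSeries.coeff_single, if_neg (by omega)]

/-! ### Reordering of words in the modes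

A mode `X_{i,j}(n)`, where `X_{i,j}` is the traceless part of the matrix unit at `(i, j)`, is encoded
by the natural number `36 (n + 8) + 6 i + j`. -/

/-- Linear combinations of words. -/
abbrev Poly : Type := List (ℤ × List ℕ)

/-- The commutator of two encoded modes, scaled by `6`, without its central term. -/
def brk (a b : ℕ) : List (ℤ × ℕ) :=
  (if a % 6 = b / 6 % 6 then [(6, 36 * (a / 36 + b / 36 - 8) + 6 * (a / 6 % 6) + b % 6)] else []) ++
  (if b % 6 = a / 6 % 6 then [(-6, 36 * (a / 36 + b / 36 - 8) + 6 * (b / 6 % 6) + a % 6)] else [])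

/-- The central term of the commutator of two encoded modes at level `-7/2`, scaled by `36`. -/
def ctr (a b : ℕ) : ℤ :=
  if a / 36 + b / 36 = 16 then
    -- -126 is 36 · (-7/2). The traceless parts pair to δδ - δδ/6, and the correction contributes
    -- -126 · (-1/6) = 21.
    ((a / 36 : ℕ) - 8 : ℤ) * ((if a % 6 = b / 6 % 6 then if b % 6 = a / 6 % 6 then -126 else 0 else 0) +
      (if a % 6 = a / 6 % 6 then if b % 6 = b / 6 % 6 then 21 else 0 else 0))
  else 0

/-- Multiplication by a scalar. -/
def scale (c : ℤ) (p : Poly) : Poly := p.map fun t => (c * t.1, t.2)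

/-- The product of an encoded mode with an ordered word, applied to the vacuum, written in terms of
ordered words as far as the first argument (the number of steps allowed) admits. -/
def act : ℕ → ℕ → List ℕ → Poly
  | 0, a, w => [(1, a :: w)]
  -- Codes from 288 = 36 · 8 on are modes of degree at least 0, which kill the vacuum.
  | _ + 1, a, [] => if 288 ≤ a then [] else [(1, [a])]
  | f + 1, a, b :: w =>
    if a ≤ b then [(1, a :: b :: w)]
    -- Here the degree of the bracket would be below -8 and the truncated subtraction in `brk` would
    -- be wrong, so the word is left unsorted.
    else if a / 36 + b / 36 < 8 then [(1, a :: b :: w)]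
    else (act f a w).flatMap (fun t => scale t.1 (act f b t.2)) ++
      ((brk a b).flatMap (fun t => scale t.1 (act f t.2 w)) ++
        if ctr a b = 0 then [] else [(ctr a b, w)])

/-- The action of an encoded mode on a linear combination of ordered words. -/
def actPoly (a : ℕ) (p : Poly) : Poly := p.flatMap fun t => scale t.1 (act 30 a t.2)

/-- Search trees whose nodes are words with coefficients. -/
inductive Tree : Type
  | leaf : Tree
  | node (l : Tree) (key : ℕ) (w : List ℕ) (c : ℤ) (r : Tree) : Tree

/-- The key by which a word is stored in a search tree. -/
def wordKey (w : List ℕ) : ℕ := w.foldl (fun x a => 1024 * x + a) 0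

/-- Insertion of a term into a search tree. -/
def Tree.insert (k : ℕ) (w : List ℕ) (c : ℤ) : Tree → Tree
  | .leaf => .node .leaf k w c .leaf
  | .node l k' w' c' r =>
    if k < k' then .node (l.insert k w c) k' w' c' r
    else if w = w' then .node l k' w' (c' + c) r
    else .node l k' w' c' (r.insert k w c)

/-- Whether all coefficients in a search tree vanish. -/
def Tree.isZero : Tree → Bool
  | .leaf => true
  | .node l _ _ c r => decide (c = 0) && l.isZero && r.isZero

/-- The search tree of a linear combination of words. -/
def Poly.toTree (p : Poly) : Tree := p.foldl (fun t x => t.insert (wordKey x.2) x.2 x.1) .leaf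

/-- The encoding of a symbol, scaled by `6`. -/
def Sym.encode : Sym → List (ℤ × ℕ)
  | .e i j n => [(1, 36 * (n + 8).toNat + 6 * (i - 1) + (j - 1))]
  | .f i j n => [(1, 36 * (n + 8).toNat + 6 * (j - 1) + (i - 1))]
  | .h i n => [(1, 36 * (n + 8).toNat + 6 * (i - 1) + (i - 1)), (-1, 36 * (n + 8).toNat + 6 * i + i)]

/-- The encoding of a product of symbols. -/
def encodeWord : List Sym → Poly
  | [] => [(1, [])]
  | s :: w => s.encode.flatMap fun t => scale t.1 ((encodeWord w).flatMap fun u => [(u.1, t.2 :: u.2)])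

/-- The encoding of a term, scaled by `30 * 6 ^ 4`. -/
def encodeTerm (t : ℚ × List Sym) : Poly :=
  -- The factor 30 clears the denominators of the coefficients. A word of length r already carries 6
  -- ^ r from its scaled modes, and the power of 6 makes this 6 ^ 4 for every term.
  scale ((t.1 * 30).num * 6 ^ (4 - t.2.length)) (encodeWord t.2)

/-- The encoding of `v`, scaled by `30 * 6 ^ 4`. -/
def vPoly : Poly := vTerms.flatMap encodeTerm

/-- The expression of a word in terms of ordered words. -/
def normWord : List ℕ → Poly
  | [] => [(1, [])]
  | a :: w => actPoly a (normWord w)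

/-- The action of an encoded mode on a linear combination of words. -/
def actWords (a : ℕ) (p : Poly) : Poly := p.flatMap fun t => scale t.1 (normWord (a :: t.2))

/-- Well-formed symbols of negative mode. -/
def Sym.ok : Sym → Bool
  | .e i j n => decide (1 ≤ i ∧ i < j ∧ j ≤ 6 ∧ -8 ≤ n ∧ n < 0)
  | .f i j n => decide (1 ≤ i ∧ i < j ∧ j ≤ 6 ∧ -8 ≤ n ∧ n < 0)
  | .h i n => decide (1 ≤ i ∧ i ≤ 5 ∧ -8 ≤ n ∧ n < 0)

/-- The encoded modes `e_{1,2}(0), …, e_{5,6}(0), f_{1,6}(1)`. -/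
def raisingCodes : List ℕ := [289, 296, 303, 310, 317, 354]

/-- The computational core of singularity. Since the diagonal traceless units sum to 0, the sorted
words are linearly dependent; the coefficients nevertheless vanish word by word, which is more than
needed. -/
theorem isZero_actWords : raisingCodes.all (fun a => (actWords a vPoly).toTree.isZero) = true := by
  decide +kernel

theorem ok_vTerms : vTerms.all (fun t => decide (((t.1 * 30).num : ℚ) = t.1 * 30) &&
    decide (t.2.length ≤ 4) && t.2.all Sym.ok) = true := by
  decide +kernel

/-! ### Commutation relations on the vacuum module -/

/-- The generators lie in the centralizer of K. Lifting them to a homomorphism into that subalgebra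
and composing with the inclusion gives the identity of U(ĝ), so every element lies there. -/
theorem centralU_mul_comm (u : U) : centralU * u = u * centralU := by
  have h (a : Affine) :
      UniversalEnvelopingAlgebra.ι ℂ a ∈ Subalgebra.centralizer ℂ ({centralU} : Set U) := by
    rw [Subalgebra.mem_centralizer_iff]
    rintro _ rfl
    have := LieHom.map_lie (UniversalEnvelopingAlgebra.ι ℂ) central a
    rw [lie_central, map_zero, LieRing.of_associative_ring_bracket] at this
    exact sub_eq_zero.1 this.symm
  let f : Affine →ₗ⁅ℂ⁆ Subalgebra.centralizer ℂ ({centralU} : Set U) :=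
    { toFun := fun a => ⟨UniversalEnvelopingAlgebra.ι ℂ a, h a⟩
      map_add' := fun a b => Subtype.ext (map_add _ a b)
      map_smul' := fun c a => Subtype.ext (map_smul _ c a)
      map_lie' := fun {a b} => Subtype.ext (LieHom.map_lie _ a b) }
  have hf : (Subalgebra.val _).comp (UniversalEnvelopingAlgebra.lift ℂ f) = AlgHom.id ℂ U := by
    apply UniversalEnvelopingAlgebra.hom_ext
    ext a
    simp only [LieHom.comp_apply, AlgHom.coe_toLieHom, AlgHom.comp_apply,
      UniversalEnvelopingAlgebra.lift_ι_apply]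
    rfl
  have hu : (UniversalEnvelopingAlgebra.lift ℂ f u : U) = u := DFunLike.congr_fun hf u
  rw [← hu]
  exact (Subalgebra.mem_centralizer_iff ℂ).1 (UniversalEnvelopingAlgebra.lift ℂ f u).2 _ rfl

/-- The vacuum ideal is only a left ideal, so centrality is needed to write (K - k)u as u(K - k). -/
theorem centralU_smul {k : ℂ} (w : V k) : centralU • w = k • w := by
  obtain ⟨u, rfl⟩ := Submodule.Quotient.mk_surjective _ w
  rw [← Submodule.Quotient.mk_smul, ← Submodule.Quotient.mk_smul, Submodule.Quotient.eq,
    smul_eq_mul, centralU_mul_comm, Algebra.smul_def, Algebra.commutes, ← mul_sub]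
  exact Submodule.smul_mem _ u (Submodule.subset_span (Or.inr rfl))

theorem mode_smul_mode_smul {k : ℂ} (x y : sl6) (m n : ℤ) (w : V k) :
    mode x m • mode y n • w = mode y n • mode x m • w + mode ⁅x, y⁆ (m + n) • w +
      (if m + n = 0 then (m : ℂ) * form x y * k else 0) • w := by
  have h : mode x m * mode y n = mode y n * mode x m + mode ⁅x, y⁆ (m + n) +
      (if m + n = 0 then (m : ℂ) * form x y else 0) • centralU := by
    have := LieHom.map_lie (UniversalEnvelopingAlgebra.ι ℂ) (loop m x) (loop n y)
    rw [lie_loop, map_add, map_smul, LieRing.of_associative_ring_bracket] at this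
    rw [add_assoc, mode, mode, mode, centralU, this]
    abel
  rw [← mul_smul, h, add_smul, add_smul, mul_smul, smul_assoc, centralU_smul]
  congr 1
  rw [smul_smul, ite_mul, zero_mul]

theorem mode_smul_vac {k : ℂ} (x : sl6) {n : ℤ} (hn : 0 ≤ n) : mode x n • vac k = 0 := by
  rw [vac, ← Submodule.Quotient.mk_smul, Submodule.Quotient.mk_eq_zero, smul_eq_mul, mul_one]
  exact Submodule.subset_span (Or.inl ⟨x, n, hn, rfl⟩)

theorem mode_add (x y : sl6) (n : ℤ) : mode (x + y) n = mode x n + mode y n := by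
  have : loop n (x + y) = loop n x + loop n y := by
    simp [loop, TensorProduct.tmul_add, ← LieAlgebra.of_add]
  rw [mode, this, map_add]
  rfl

theorem mode_smul (c : ℂ) (x : sl6) (n : ℤ) : mode (c • x) n = c • mode x n := by
  have : loop n (c • x) = c • loop n x := by
    simp [loop, ← LieAlgebra.of_smul]
  rw [mode, this, map_smul]
  rfl

/-- The mode `x(n)` as a linear function of `x`. -/
def modeₗ (n : ℤ) : sl6 →ₗ[ℂ] U where
  toFun x := mode x n
  map_add' x y := mode_add x y n
  map_smul' c x := mode_smul c x n

theorem mode_zero (n : ℤ) : mode 0 n = 0 := (modeₗ n).map_zero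

theorem mode_sub (x y : sl6) (n : ℤ) : mode (x - y) n = mode x n - mode y n :=
  (modeₗ n).map_sub x y

/-! ### The spanning set of traceless matrix units -/

/-- The traceless part of a matrix unit. -/
def unit (i j : Fin 6) : sl6 :=
  ⟨Matrix.single i j 1 - (if i = j then 1 / 6 else 0 : ℂ) • 1, by
    rw [LieAlgebra.SpecialLinear.sl, ← LieSubalgebra.mem_toSubmodule]
    simp only [LinearMap.mem_ker, Matrix.traceLinearMap_apply, Matrix.trace_sub, Matrix.trace_smul,
      Matrix.trace_one, Fintype.card_fin]
    split_ifs with h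
    · subst h
      rw [Matrix.trace_single_eq_same]
      norm_num
    · rw [Matrix.trace_single_eq_of_ne _ _ _ h]
      norm_num⟩

theorem unit_val (i j : Fin 6) :
    (unit i j).1 = Matrix.single i j 1 - (if i = j then 1 / 6 else 0 : ℂ) • 1 := rfl

theorem single_mul_single_ite (i j k l : Fin 6) :
    Matrix.single i j (1 : ℂ) * Matrix.single k l 1 = if j = k then Matrix.single i l 1 else 0 := by
  split_ifs with h
  · subst h; simp
  · rw [Matrix.single_mul_single_of_ne _ _ _ _ h]

/-- Multiples of the identity do not affect the commutator, so the matrix unit relations survive. On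
the right the trace corrections appear only when j = k, l = i, and i = l makes them cancel or i ≠ j
etc. makes them vanish. -/
theorem unit_lie (i j k l : Fin 6) :
    ⁅unit i j, unit k l⁆ = (if j = k then unit i l else 0) - if l = i then unit k j else 0 := by
  apply Subtype.ext
  have h : (⁅unit i j, unit k l⁆ : sl6).1 = Matrix.single i j (1 : ℂ) * Matrix.single k l 1 -
      Matrix.single k l 1 * Matrix.single i j 1 := by
    rw [LieAlgebra.SpecialLinear.sl_bracket, unit_val, unit_val]
    simp only [mul_sub, sub_mul, smul_mul_assoc, mul_smul_comm, one_mul, mul_one, smul_sub, smul_smul]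
    rw [mul_comm (if k = l then 1 / 6 else 0 : ℂ)]
    abel
  rw [h, single_mul_single_ite, single_mul_single_ite]
  have h2 (p : Prop) [Decidable p] (x : sl6) : (if p then x else 0 : sl6).1 = if p then x.1 else 0 := by
    split_ifs <;> rfl
  change _ = (if j = k then unit i l else 0 : sl6).1 - (if l = i then unit k j else 0 : sl6).1
  rw [h2, h2, unit_val, unit_val]
  by_cases h3 : j = k <;> by_cases h4 : l = i
  · subst h3 h4
    simp
  · subst h3
    simp [h4, Ne.symm h4]
  · subst h4
    simp [h3, Ne.symm h3]
  · simp [h3, h4]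

theorem form_unit (x : sl6) (i j : Fin 6) : form x (unit i j) = x.1 j i := by
  have hx : Matrix.trace x.1 = 0 := LinearMap.mem_ker.1 x.2
  rw [form_apply, unit_val, mul_sub, Matrix.mul_smul, mul_one, Matrix.trace_sub, Matrix.trace_smul, hx,
    smul_zero, sub_zero, Matrix.trace_mul_single]
  simp

theorem unit_apply (i j a b : Fin 6) : (unit i j).1 a b =
    (if i = a then if j = b then 1 else 0 else 0) - if i = j then if a = b then 1 / 6 else 0 else 0 := by
  rw [unit_val, Matrix.sub_apply, Matrix.smul_apply, Matrix.single_apply, Matrix.one_apply]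
  split_ifs <;> simp_all

theorem matrixUnit_succ {i j : Fin 6} (h : i ≠ j) : matrixUnit (i + 1) (j + 1) = unit i j := by
  apply Subtype.ext
  ext a b
  rw [unit_apply, if_neg h, sub_zero]
  simp only [matrixUnit, Matrix.of_apply, Fin.ext_iff] at *
  split_ifs <;> first | rfl | omega

theorem coroot_succ {i j : Fin 6} (h : i.val + 1 = j) : coroot j = unit i i - unit j j := by
  have h1 : i ≠ j := fun e => by subst e; omega
  have h2 : matrixUnit j (j + 1) = unit i j := by rw [← matrixUnit_succ h1, h]
  have h3 : matrixUnit (j + 1) j = unit j i := by rw [← matrixUnit_succ h1.symm, h]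
  rw [coroot, h2, h3, unit_lie, if_pos rfl, if_pos rfl]

/-! ### Soundness of the reordering -/

/-- The residue of a natural number modulo `6`. -/
def residue (n : ℕ) : Fin 6 := ⟨n % 6, Nat.mod_lt _ (by norm_num)⟩

/-- The mode with the given code, scaled by `6`. -/
def gen (c : ℕ) : U := (6 : ℂ) • mode (unit (residue (c / 6)) (residue c)) ((c / 36 : ℕ) - 8)

theorem gen_code (m : ℕ) (i j : Fin 6) :
    gen (36 * m + 6 * i + j) = (6 : ℂ) • mode (unit i j) ((m : ℤ) - 8) := by
  have h1 : residue ((36 * m + 6 * i + j) / 6) = i := by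
    ext; simp only [residue]; omega
  have h2 : residue (36 * m + 6 * i + j) = j := by
    ext; simp only [residue]; omega
  have h3 : (36 * m + 6 * i.val + j.val) / 36 = m := by omega
  rw [gen, h1, h2, h3]

theorem gen_code_residue (m p q : ℕ) : gen (36 * m + 6 * (p / 6 % 6) + q % 6) =
    (6 : ℂ) • mode (unit (residue (p / 6)) (residue q)) ((m : ℤ) - 8) :=
  gen_code m (residue (p / 6)) (residue q)

/-- The hypothesis makes the truncated subtraction in `brk` equal to the true sum of degrees. The
product of two scaled modes carries 36, of which one 6 is absorbed by the scaled mode of the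
bracket. -/
theorem gen_smul_gen_smul {a b : ℕ} (h : 8 ≤ a / 36 + b / 36) (x : V (-7 / 2)) :
    gen a • gen b • x = gen b • gen a • x +
      (((brk a b).map fun t => t.1 • gen t.2 • x).sum + ctr a b • x) := by
  have hr (p q : ℕ) : residue p = residue q ↔ p % 6 = q % 6 := by
    simp only [residue, Fin.mk.injEq]
  have hm : ((a / 36 + b / 36 - 8 : ℕ) : ℤ) - 8 = ((a / 36 : ℕ) - 8 : ℤ) + ((b / 36 : ℕ) - 8) := by
    omega
  have hb : ((brk a b).map fun t => t.1 • gen t.2 • x).sum =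
      (36 : ℂ) • mode ⁅unit (residue (a / 6)) (residue a), unit (residue (b / 6)) (residue b)⁆
        (((a / 36 : ℕ) - 8 : ℤ) + ((b / 36 : ℕ) - 8)) • x := by
    rw [unit_lie, mode_sub, sub_smul, smul_sub, brk, List.map_append, List.sum_append, sub_eq_add_neg]
    congr 1
    · by_cases h1 : a % 6 = b / 6 % 6
      · rw [if_pos h1, if_pos ((hr _ _).2 h1)]
        simp only [List.map_cons, List.map_nil, List.sum_cons, List.sum_nil, add_zero]
        rw [gen_code_residue, hm, smul_assoc, ← Int.cast_smul_eq_zsmul ℂ, smul_smul]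
        norm_num
      · rw [if_neg h1, if_neg (mt (hr _ _).1 h1), mode_zero]
        simp
    · by_cases h1 : b % 6 = a / 6 % 6
      · rw [if_pos h1, if_pos ((hr _ _).2 h1)]
        simp only [List.map_cons, List.map_nil, List.sum_cons, List.sum_nil, add_zero]
        rw [gen_code_residue, hm, smul_assoc, ← Int.cast_smul_eq_zsmul ℂ, smul_smul]
        norm_num
      · rw [if_neg h1, if_neg (mt (hr _ _).1 h1), mode_zero]
        simp
  have hc : ctr a b • x = (36 : ℂ) •
      (if ((a / 36 : ℕ) - 8 : ℤ) + ((b / 36 : ℕ) - 8) = 0 then (((a / 36 : ℕ) - 8 : ℤ) : ℂ) *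
        form (unit (residue (a / 6)) (residue a)) (unit (residue (b / 6)) (residue b)) * (-7 / 2)
        else 0) • x := by
    rw [← Int.cast_smul_eq_zsmul ℂ, smul_smul, form_unit, unit_apply, ctr]
    congr 1
    simp only [hr]
    by_cases h0 : a / 36 + b / 36 = 16
    · have hz : ((a / 36 : ℕ) - 8 : ℤ) + ((b / 36 : ℕ) - 8) = 0 := by omega
      have e1 : (a / 6 % 6 = b % 6) = (b % 6 = a / 6 % 6) := propext eq_comm
      have e2 : (a / 6 % 6 = a % 6) = (a % 6 = a / 6 % 6) := propext eq_comm
      rw [if_pos h0, if_pos hz]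
      simp only [e1, e2]
      generalize ((a / 36 : ℕ) - 8 : ℤ) = z
      push_cast
      split_ifs <;> ring
    · have hz : ¬((a / 36 : ℕ) - 8 : ℤ) + ((b / 36 : ℕ) - 8) = 0 := by omega
      rw [if_neg h0, if_neg hz]
      simp
  rw [hb, hc, gen, gen]
  simp only [smul_assoc, smul_comm _ (6 : ℂ)]
  rw [mode_smul_mode_smul, show (36 : ℂ) = 6 * 6 by norm_num]
  simp only [smul_add, mul_smul, add_assoc]

/-- The vector denoted by an encoded word. -/
def evalWord (w : List ℕ) : V (-7 / 2) := w.foldr (fun a x => gen a • x) (vac _)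

theorem evalWord_cons (a : ℕ) (w : List ℕ) : evalWord (a :: w) = gen a • evalWord w := rfl

/-- The vector denoted by a linear combination of encoded words. -/
def evalPoly (p : Poly) : V (-7 / 2) := (p.map fun t => t.1 • evalWord t.2).sum

theorem evalPoly_nil : evalPoly [] = 0 := rfl

theorem evalPoly_cons (t : ℤ × List ℕ) (p : Poly) :
    evalPoly (t :: p) = t.1 • evalWord t.2 + evalPoly p := by
  simp [evalPoly]

theorem evalPoly_append (p q : Poly) : evalPoly (p ++ q) = evalPoly p + evalPoly q := by
  simp [evalPoly]

theorem evalPoly_scale (c : ℤ) (p : Poly) : evalPoly (scale c p) = c • evalPoly p := by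
  induction p with
  | nil => simp [scale, evalPoly_nil]
  | cons t p ih =>
    have : scale c (t :: p) = (c * t.1, t.2) :: scale c p := rfl
    rw [this, evalPoly_cons, evalPoly_cons, ih, smul_add, mul_smul]

theorem evalPoly_flatMap_scale {α : Type*} (l : List (ℤ × α)) (F : α → Poly) :
    evalPoly (l.flatMap fun t => scale t.1 (F t.2)) =
      (l.map fun t => t.1 • evalPoly (F t.2)).sum := by
  induction l with
  | nil => rfl
  | cons t l ih => rw [List.flatMap_cons, evalPoly_append, evalPoly_scale, ih]; rfl

theorem smul_evalPoly (u : U) (p : Poly) :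
    u • evalPoly p = (p.map fun t => t.1 • u • evalWord t.2).sum := by
  induction p with
  | nil => simp [evalPoly_nil]
  | cons t p ih => rw [evalPoly_cons, smul_add, ih, smul_comm]; rfl

/-- Valid for every step bound `f`, because exhaustion returns the word unchanged. The bound 30 in
`actPoly` therefore needs no justification, and `w` need not be sorted. -/
theorem evalPoly_act (f a : ℕ) (w : List ℕ) : evalPoly (act f a w) = gen a • evalWord w := by
  induction f generalizing a w with
  | zero => simp [act, evalPoly_cons, evalPoly_nil, evalWord_cons]
  | succ f ih =>
    match w with
    | [] =>
      rw [act]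
      split_ifs with h
      · rw [evalPoly_nil, gen, smul_assoc]
        change 0 = (6 : ℂ) • mode _ _ • vac (-7 / 2)
        rw [mode_smul_vac _ (by omega), smul_zero]
      · simp [evalPoly_cons, evalPoly_nil, evalWord_cons]
    | b :: w =>
      rw [act]
      split_ifs with h1 h2 h3
      · simp [evalPoly_cons, evalPoly_nil, evalWord_cons]
      · simp [evalPoly_cons, evalPoly_nil, evalWord_cons]
      all_goals
        rw [evalWord_cons, gen_smul_gen_smul (by omega), evalPoly_append, evalPoly_append,
          evalPoly_flatMap_scale, evalPoly_flatMap_scale (F := fun c => act f c w)]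
        simp only [ih]
        rw [← smul_evalPoly, ih]
      · rw [h3, zero_smul, evalPoly_nil]
      · rw [evalPoly_cons, evalPoly_nil, add_zero]

theorem evalPoly_normWord (w : List ℕ) : evalPoly (normWord w) = evalWord w := by
  induction w with
  | nil => simp [normWord, evalPoly_cons, evalPoly_nil]
  | cons a w ih =>
    rw [normWord, actPoly, evalPoly_flatMap_scale]
    simp only [evalPoly_act]
    rw [← smul_evalPoly, ih, evalWord_cons]

theorem evalPoly_actWords (a : ℕ) (p : Poly) : evalPoly (actWords a p) = gen a • evalPoly p := by
  rw [actWords, evalPoly_flatMap_scale (F := fun w => normWord (a :: w)), smul_evalPoly]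
  simp only [evalPoly_normWord, evalWord_cons]

/-- The vector denoted by a search tree. -/
def evalTree : Tree → V (-7 / 2)
  | .leaf => 0
  | .node l _ w c r => evalTree l + c • evalWord w + evalTree r

/-- Coefficients are merged only after the words are compared, so neither the ordering of the tree
nor injectivity of `wordKey` matters. -/
theorem evalTree_insert (k : ℕ) (w : List ℕ) (c : ℤ) (t : Tree) :
    evalTree (t.insert k w c) = evalTree t + c • evalWord w := by
  induction t with
  | leaf => simp [Tree.insert, evalTree]
  | node l k' w' c' r hl hr =>
    rw [Tree.insert]
    split_ifs with h1 h2
    · simp only [evalTree, hl]; abel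
    · subst h2; simp only [evalTree, add_smul]; abel
    · simp only [evalTree, hr]; abel

theorem evalTree_toTree (p : Poly) : evalTree p.toTree = evalPoly p := by
  have h (t : Tree) : evalTree (p.foldl (fun t x => t.insert (wordKey x.2) x.2 x.1) t) =
      evalTree t + evalPoly p := by
    induction p generalizing t with
    | nil => simp [evalPoly_nil]
    | cons x p ih => rw [List.foldl_cons, ih, evalTree_insert, evalPoly_cons, add_assoc]
  rw [Poly.toTree, h, evalTree, zero_add]

theorem evalTree_eq_zero {t : Tree} (h : t.isZero = true) : evalTree t = 0 := by
  induction t with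
  | leaf => rfl
  | node l k w c r hl hr =>
    simp only [Tree.isZero, Bool.and_eq_true, decide_eq_true_eq] at h
    rw [evalTree, hl h.1.2, hr h.2, h.1.1]
    simp

/-! ### The encoding of the explicit vector -/

theorem encode_sound {s : Sym} (h : s.ok = true) (x : V (-7 / 2)) :
    (s.encode.map fun t => t.1 • gen t.2 • x).sum = (6 : ℂ) • s.toU • x := by
  have hE (i j : ℕ) (n : ℤ) (hi : 1 ≤ i) (hi' : i ≤ 6) (hj : 1 ≤ j) (hj' : j ≤ 6) (hij : i ≠ j)
      (hn : -8 ≤ n) : gen (36 * (n + 8).toNat + 6 * (i - 1) + (j - 1)) =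
        (6 : ℂ) • mode (matrixUnit i j) n := by
    obtain ⟨i, rfl⟩ : ∃ i' : Fin 6, i = i' + 1 := ⟨⟨i - 1, by omega⟩, by simp; omega⟩
    obtain ⟨j, rfl⟩ : ∃ j' : Fin 6, j = j' + 1 := ⟨⟨j - 1, by omega⟩, by simp; omega⟩
    rw [Nat.add_sub_cancel, Nat.add_sub_cancel, gen_code, matrixUnit_succ (fun e => hij (by rw [e]))]
    congr 2
    omega
  cases s with
  | e i j n =>
    simp only [Sym.ok, decide_eq_true_eq] at h
    simp only [Sym.encode, List.map_cons, List.map_nil, List.sum_cons, List.sum_nil, add_zero,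
      one_smul, Sym.toU]
    rw [hE i j n (by omega) (by omega) (by omega) (by omega) (by omega) (by omega), smul_assoc]
  | f i j n =>
    simp only [Sym.ok, decide_eq_true_eq] at h
    simp only [Sym.encode, List.map_cons, List.map_nil, List.sum_cons, List.sum_nil, add_zero,
      one_smul, Sym.toU]
    rw [hE j i n (by omega) (by omega) (by omega) (by omega) (by omega) (by omega), smul_assoc]
  | h i n =>
    simp only [Sym.ok, decide_eq_true_eq] at h
    simp only [Sym.encode, List.map_cons, List.map_nil, List.sum_cons, List.sum_nil, add_zero,
      one_smul, neg_smul, Sym.toU]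
    have h1 := gen_code (n + 8).toNat ⟨i - 1, by omega⟩ ⟨i - 1, by omega⟩
    have h2 := gen_code (n + 8).toNat ⟨i, by omega⟩ ⟨i, by omega⟩
    have h3 := coroot_succ (i := ⟨i - 1, by omega⟩) (j := ⟨i, by omega⟩) (by simp; omega)
    have h4 : ((n + 8).toNat : ℤ) - 8 = n := by omega
    simp only at h1 h2 h3
    rw [h1, h2, h3, mode_sub, sub_smul, smul_sub, smul_assoc, smul_assoc, h4, sub_eq_add_neg]

theorem evalPoly_encodeWord {w : List Sym} (h : w.all Sym.ok = true) :
    evalPoly (encodeWord w) = (6 : ℂ) ^ w.length • (w.map Sym.toU).prod • vac (-7 / 2) := by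
  induction w with
  | nil => simp [encodeWord, evalPoly_cons, evalPoly_nil, evalWord]
  | cons s w ih =>
    rw [List.all_cons, Bool.and_eq_true] at h
    have hc (a : ℕ) (p : Poly) :
        evalPoly (p.flatMap fun u => [(u.1, a :: u.2)]) = gen a • evalPoly p := by
      induction p with
      | nil => simp [evalPoly_nil]
      | cons t p ih =>
        rw [List.flatMap_cons, evalPoly_append, ih, evalPoly_cons, evalPoly_cons, evalPoly_nil,
          add_zero, smul_add, evalWord_cons, smul_comm]
    rw [encodeWord, evalPoly_flatMap_scale
      (F := fun a => (encodeWord w).flatMap fun u => [(u.1, a :: u.2)])]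
    simp only [hc, ih h.2]
    rw [encode_sound h.1, List.map_cons, List.prod_cons, List.length_cons, pow_succ', mul_smul,
      mul_smul, smul_comm s.toU]

theorem evalPoly_vPoly : evalPoly vPoly = (30 * 6 ^ 4 : ℂ) • v := by
  have h := ok_vTerms
  rw [List.all_eq_true] at h
  rw [vPoly, v]
  generalize vTerms = l at h
  induction l with
  | nil => simp [evalPoly_nil]
  | cons t l ih =>
    rw [List.flatMap_cons, evalPoly_append, ih fun x hx => h x (List.mem_cons_of_mem _ hx),
      List.map_cons, List.sum_cons, smul_add]
    congr 1
    have ht := h t List.mem_cons_self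
    simp only [Bool.and_eq_true, decide_eq_true_eq] at ht
    rw [encodeTerm, evalPoly_scale, evalPoly_encodeWord ht.2, ← Int.cast_smul_eq_zsmul ℂ, smul_smul,
      smul_smul]
    congr 1
    have h1 : (((t.1 * 30).num : ℤ) : ℂ) = (t.1 : ℂ) * 30 := by
      have := congrArg (fun q : ℚ => (q : ℂ)) ht.1.1
      push_cast at this
      exact this
    push_cast
    rw [h1, mul_assoc, ← pow_add, Nat.sub_add_cancel ht.1.2]
    ring

theorem gen_smul_v {a : ℕ} (ha : a ∈ raisingCodes) : gen a • v = 0 := by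
  have h := List.all_eq_true.1 isZero_actWords a ha
  have h1 := evalTree_eq_zero h
  rw [evalTree_toTree, evalPoly_actWords, evalPoly_vPoly, smul_comm] at h1
  exact (smul_eq_zero.1 h1).resolve_left (by norm_num)

theorem mode_smul_v {m : ℕ} {i j : Fin 6} (h : 36 * m + 6 * i.val + j.val ∈ raisingCodes) :
    mode (unit i j) ((m : ℤ) - 8) • v = 0 := by
  have h1 := gen_smul_v h
  rw [gen_code, smul_assoc] at h1
  exact (smul_eq_zero.1 h1).resolve_left (by norm_num)

/-- The vector `v` is annihilated by the simple root vectors. -/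
theorem simple_smul_v {i j : Fin 6} (h : i.val + 1 = j) : mode (unit i j) 0 • v = 0 := by
  refine mode_smul_v (m := 8) ?_
  fin_cases i <;> fin_cases j <;> first | (simp at h; done) | simp [raisingCodes]

theorem lowest_smul_v : mode (unit 5 0) 1 • v = 0 := by
  refine mode_smul_v (m := 9) ?_
  simp [raisingCodes]

/-! ### Nonvanishing of the explicit vector -/

/-- All ways to remove one element from a list. -/
def removals {α : Type*} : List α → List (α × List α)
  | [] => []
  | p :: L => (p, L) :: (removals L).map fun q => (q.1, p :: q.2)

/-- The matrix entry of the coefficient of `t⁻¹` in a symbol. -/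
def Sym.entry : Sym → Fin 6 × Fin 6 → ℤ
  | .e i j n, p => if n = -1 ∧ p.1.val + 1 = i ∧ p.2.val + 1 = j then 1 else 0
  | .f i j n, p => if n = -1 ∧ p.1.val + 1 = j ∧ p.2.val + 1 = i then 1 else 0
  | .h i n, p => if n = -1 ∧ p.1.val = p.2.val then
      (if p.1.val + 1 = i then 1 else 0) - (if p.1.val = i then 1 else 0) else 0

/-- The pairing of a product of symbols with a product of coordinate functions. -/
def pairing : List Sym → List (Fin 6 × Fin 6) → ℤ
  | [], L => if L = [] then 1 else 0
  | s :: w, L => ((removals L).map fun q => s.entry q.1 * pairing w q.2).sum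

/-- Only the term 2 e_{1,3}(-1)e_{2,4}(-1)e_{3,5}(-1)e_{4,6}(-1) consists of exactly these four
entries in degree -1. The positions are numbered from 0 here. -/
theorem pairing_vTerms : (vTerms.map fun t =>
    t.1 * (pairing t.2 [(0, 2), (1, 3), (2, 4), (3, 5)] : ℚ)).sum = 2 := by
  decide +kernel

/-- The product of the first coordinate functions at the given positions. -/
def coordProd (L : List (Fin 6 × Fin 6)) : Fun := (L.map fun p => MvPolynomial.X (0, p)).prod

theorem derivation_coordProd (D : Derivation ℂ Fun Fun) (L : List (Fin 6 × Fin 6)) :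
    D (coordProd L) =
      ((removals L).map fun q => D (MvPolynomial.X (0, q.1)) * coordProd q.2).sum := by
  induction L with
  | nil => simp [coordProd, removals]
  | cons p L ih =>
    have h : coordProd (p :: L) = MvPolynomial.X (0, p) * coordProd L := by simp [coordProd]
    rw [h, Derivation.leibniz, ih, removals, List.map_cons, List.sum_cons, List.map_map, smul_eq_mul,
      smul_eq_mul, ← List.sum_map_mul_left, add_comm, mul_comm (coordProd L)]
    congr 2
    refine List.map_congr_left fun q _ => ?_
    simp only [Function.comp_apply, coordProd, List.map_cons, List.prod_cons]
    ring

theorem evalAct_sum (k : ℂ) {α : Type*} (l : List α) (c : α → ℂ) (F : α → Fun) (u : U) :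
    evalAct k ((l.map fun q => MvPolynomial.C (c q) * F q).sum) u =
      (l.map fun q => c q * evalAct k (F q) u).sum := by
  induction l with
  | nil => simp [evalAct]
  | cons q l ih =>
    rw [List.map_cons, List.sum_cons, List.map_cons, List.sum_cons, ← ih]
    simp only [evalAct, LinearMap.coe_mk, AddHom.coe_mk, map_add, ← MvPolynomial.smul_eq_C_mul,
      map_smul, MvPolynomial.smul_eval]

theorem Sym.ok_entry {s : Sym} (h : s.ok = true) :
    ∃ (x : sl6) (n : ℤ), s.toU = mode x n ∧ n < 0 ∧
      ∀ i j, (if n = -1 then x.1 i j else 0) = (s.entry (i, j) : ℂ) := by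
  cases s with
  | e i j n =>
    simp only [Sym.ok, decide_eq_true_eq] at h
    refine ⟨_, n, rfl, by omega, fun a b => ?_⟩
    simp only [matrixUnit, Matrix.of_apply, Sym.entry]
    have : i ≠ j := by omega
    split_ifs <;> simp_all
  | f i j n =>
    simp only [Sym.ok, decide_eq_true_eq] at h
    refine ⟨_, n, rfl, by omega, fun a b => ?_⟩
    simp only [matrixUnit, Matrix.of_apply, Sym.entry]
    have : j ≠ i := by omega
    split_ifs <;> simp_all
  | h i n =>
    simp only [Sym.ok, decide_eq_true_eq] at h
    refine ⟨_, n, rfl, by omega, fun a b => ?_⟩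
    have h3 := coroot_succ (i := ⟨i - 1, by omega⟩) (j := ⟨i, by omega⟩) (by simp; omega)
    simp only at h3
    rw [h3]
    have h4 (x y : sl6) : (x - y).1 a b = x.1 a b - y.1 a b := rfl
    simp only [h4, unit_apply, Sym.entry, Fin.ext_iff]
    by_cases hn : n = -1
    · by_cases hab : a.val = b.val
      · simp only [hn, hab, true_and, if_true]
        have e1 : (i - 1 = b.val) = (b.val + 1 = i) := propext (by omega)
        have e2 : (i = b.val) = (b.val = i) := propext (by omega)
        simp only [e1, e2]
        split_ifs <;> norm_num
      · simp only [hn, hab, and_false, if_true, if_false, ite_self, sub_zero, Int.cast_zero]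
        split_ifs <;> first | omega | simp
    · simp [hn]

/-- Negative modes have zero charge and act as derivations with constant values on the coordinates
in question, so each letter removes one coordinate. The level drops out. -/
theorem evalAct_coordProd {k : ℂ} {w : List Sym} (hw : w.all Sym.ok = true)
    (L : List (Fin 6 × Fin 6)) :
    evalAct k (coordProd L) (w.map Sym.toU).prod = pairing w L := by
  induction w generalizing L with
  | nil =>
    rw [List.map_nil, List.prod_nil, evalAct_one, pairing]
    cases L <;> simp [coordProd]
  | cons s w ih =>
    rw [List.all_cons, Bool.and_eq_true] at hw
    obtain ⟨x, n, hs, hn, hx⟩ := Sym.ok_entry hw.1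
    rw [List.map_cons, List.prod_cons, hs, mode, evalAct_ι_mul, actFun_apply, charge_loop_neg hn,
      centralCoeff_loop, map_zero, add_zero, mul_zero, zero_mul, add_zero, derivation_coordProd]
    simp only [field_loop_neg hn, hx]
    rw [evalAct_sum, pairing]
    simp only [ih hw.2]
    generalize removals L = l
    induction l with
    | nil => simp
    | cons q l ih => simp [ih]

theorem v_ne_zero : v ≠ 0 := by
  intro h0
  have hv (l : List (ℚ × List Sym)) :
      (l.map fun t => (t.1 : ℂ) • (t.2.map Sym.toU).prod • vac (-7 / 2)).sum =
        Submodule.Quotient.mk (l.map fun t => (t.1 : ℂ) • (t.2.map Sym.toU).prod).sum := by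
    induction l with
    | nil => rfl
    | cons t l ih =>
      rw [List.map_cons, List.sum_cons, ih, List.map_cons, List.sum_cons, Submodule.Quotient.mk_add,
        Submodule.Quotient.mk_smul, vac, ← Submodule.Quotient.mk_smul, smul_eq_mul, mul_one]
  rw [v, hv, Submodule.Quotient.mk_eq_zero] at h0
  -- If v were 0, its representative would lie in the ideal and this functional would vanish on it;
  -- `pairing_vTerms` gives 2.
  have h1 := evalAct_vacuumIdeal h0 (coordProd [(0, 2), (1, 3), (2, 4), (3, 5)])
  have h2 := ok_vTerms
  have h3 := congrArg (fun q : ℚ => (q : ℂ)) pairing_vTerms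
  rw [List.all_eq_true] at h2
  have h4 (l : List (ℚ × List Sym)) (hl : ∀ t ∈ l, t.2.all Sym.ok = true)
      (L : List (Fin 6 × Fin 6)) :
      evalAct (-7 / 2) (coordProd L) (l.map fun t => (t.1 : ℂ) • (t.2.map Sym.toU).prod).sum =
        (((l.map fun t => t.1 * (pairing t.2 L : ℚ)).sum : ℚ) : ℂ) := by
    induction l with
    | nil => simp
    | cons t l ih =>
      rw [List.map_cons, List.sum_cons, map_add, map_smul,
        evalAct_coordProd (hl t List.mem_cons_self), ih fun x hx => hl x (List.mem_cons_of_mem _ hx)]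
      simp
  rw [h4 vTerms fun t ht => by
    have := h2 t ht
    simp only [Bool.and_eq_true] at this
    exact this.2, pairing_vTerms] at h1
  norm_num at h1

/-! ### Singularity of the explicit vector -/

theorem sl6_sum_apply {α : Type*} (s : Finset α) (f : α → sl6) (a b : Fin 6) :
    (∑ i ∈ s, f i).1 a b = ∑ i ∈ s, (f i).1 a b := by
  let e : sl6 →+ ℂ := { toFun := fun x => x.1 a b, map_zero' := rfl, map_add' := fun _ _ => rfl }
  exact map_sum e f s

theorem sum_smul_unit (x : sl6) : x = ∑ i, ∑ j, x.1 i j • unit i j := by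
  have hx : ∑ i, x.1 i i = 0 := LinearMap.mem_ker.1 x.2
  have h' (c : ℂ) (y : sl6) (a b : Fin 6) : (c • y).1 a b = c * y.1 a b := rfl
  apply Subtype.ext
  ext a b
  simp only [sl6_sum_apply, h', unit_apply, mul_sub, Finset.sum_sub_distrib, mul_ite, mul_one,
    mul_zero, Finset.sum_ite_eq, Finset.sum_ite_eq', Finset.mem_univ, if_true, Finset.sum_ite_irrel,
    Finset.sum_const_zero]
  split_ifs
  · rw [← Finset.sum_mul, hx, zero_mul, sub_zero]
  · rw [sub_zero]

theorem sum_unit_self : ∑ i, unit i i = 0 := by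
  have h' (a b : Fin 6) : (0 : sl6).1 a b = 0 := rfl
  apply Subtype.ext
  ext a b
  rw [sl6_sum_apply, h']
  simp only [unit_apply, if_true, Finset.sum_sub_distrib, Finset.sum_ite_eq', Finset.mem_univ,
    Finset.sum_const, Finset.card_univ, Fintype.card_fin]
  split_ifs <;> norm_num

/-- A subspace of `sl₆` which contains the root vectors and their commutators is everything. -/
theorem eq_top_of_unit_mem {D : Submodule ℂ sl6} (h : ∀ i j, i ≠ j → unit i j ∈ D)
    (h' : ∀ i, i ≠ 5 → unit i i - unit 5 5 ∈ D) : D = ⊤ := by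
  have h5 : unit 5 5 ∈ D := by
    -- The sum equals -6 · `unit 5 5`, since the diagonal units add up to 0.
    have h1 : ∑ i : Fin 6, (unit i i - unit 5 5) ∈ D := D.sum_mem fun i _ => by
      by_cases hi : i = 5
      · rw [hi, sub_self]; exact D.zero_mem
      · exact h' i hi
    rw [Finset.sum_sub_distrib, sum_unit_self, Finset.sum_const, Finset.card_univ, Fintype.card_fin,
      zero_sub, ← Nat.cast_smul_eq_nsmul ℂ, ← neg_smul] at h1
    exact (D.smul_mem_iff (by norm_num)).1 h1
  rw [eq_top_iff]
  intro x _
  rw [sum_smul_unit x]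
  refine D.sum_mem fun i _ => D.sum_mem fun j _ => D.smul_mem _ ?_
  by_cases hij : i = j
  · subst hij
    by_cases hi : i = 5
    · rw [hi]; exact h5
    · simpa using D.add_mem (h' i hi) h5
  · exact h i j hij

theorem unit_lie_of_ne {i j : Fin 6} (k : Fin 6) (h : i ≠ j) :
    ⁅unit i k, unit k j⁆ = unit i j := by
  rw [unit_lie, if_pos rfl, if_neg h.symm, sub_zero]

/-- The elements of `sl₆` whose `n`-th mode annihilates a vector. -/
def annihilator {k : ℂ} (n : ℤ) (w : V k) : Submodule ℂ sl6 where
  carrier := {x | mode x n • w = 0}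
  zero_mem' := by simp [mode_zero]
  add_mem' := by
    intro x y hx hy
    simp only [Set.mem_ofPred_eq] at hx hy ⊢
    rw [mode_add, add_smul, hx, hy, add_zero]
  smul_mem' := by
    intro c x hx
    simp only [Set.mem_ofPred_eq] at hx ⊢
    rw [mode_smul, smul_assoc, hx, smul_zero]

theorem mem_annihilator {k : ℂ} {n : ℤ} {w : V k} {x : sl6} :
    x ∈ annihilator n w ↔ mode x n • w = 0 := Iff.rfl

/-- No central term arises: for nonnegative degrees m + n = 0 forces m = 0, and the cocycle has the
factor m. -/
theorem lie_mem_annihilator {k : ℂ} {m n p : ℤ} {w : V k} {x y : sl6} (hx : x ∈ annihilator m w)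
    (hy : y ∈ annihilator n w) (hp : m + n = p) (hm : 0 ≤ m) (hn : 0 ≤ n) :
    ⁅x, y⁆ ∈ annihilator p w := by
  subst hp
  rw [mem_annihilator] at *
  have h := mode_smul_mode_smul x y m n w
  have hc : (if m + n = 0 then (m : ℂ) * form x y * k else 0) = 0 := by
    split_ifs with h0
    · obtain rfl : m = 0 := by omega
      simp
    · rfl
  rw [hx, hy, smul_zero, smul_zero, zero_add, hc, zero_smul, add_zero] at h
  exact h.symm

theorem upper_mem_annihilator {i j : Fin 6} (h : i < j) : unit i j ∈ annihilator 0 v := by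
  obtain ⟨d, hd⟩ : ∃ d : ℕ, i.val + d + 1 = j := ⟨j - i - 1, by omega⟩
  induction d generalizing j with
  | zero => exact mem_annihilator.2 (simple_smul_v hd)
  | succ d ih =>
    have hk : i.val + d + 1 < 6 := by omega
    rw [← unit_lie_of_ne ⟨i.val + d + 1, hk⟩ h.ne]
    refine lie_mem_annihilator (ih ?_ rfl) (mem_annihilator.2 (simple_smul_v ?_)) (zero_add 0)
      le_rfl le_rfl
    · rw [Fin.lt_def]; simp only; omega
    · simp only; omega

/-- The adjoint representation is generated by its lowest root vector under n_+. Brackets with upper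
triangular units move an entry up (`hl`) or to the right (`hr`), starting from the bottom left
corner. -/
theorem annihilator_one : annihilator 1 v = ⊤ := by
  have hl {i j : Fin 6} (k : Fin 6) (hik : i < k) (hij : i ≠ j) (h : unit k j ∈ annihilator 1 v) :
      unit i j ∈ annihilator 1 v := by
    rw [← unit_lie_of_ne k hij]
    exact lie_mem_annihilator (upper_mem_annihilator hik) h (zero_add 1) le_rfl zero_le_one
  have hr {i j : Fin 6} (k : Fin 6) (hkj : k < j) (hij : i ≠ j) (h : unit i k ∈ annihilator 1 v) :
      unit i j ∈ annihilator 1 v := by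
    rw [← unit_lie_of_ne k hij]
    exact lie_mem_annihilator h (upper_mem_annihilator hkj) (add_zero 1) zero_le_one le_rfl
  have h5 (j : Fin 6) (hj : j ≠ 5) : unit 5 j ∈ annihilator 1 v := by
    by_cases h0 : j = 0
    · rw [h0]; exact mem_annihilator.2 lowest_smul_v
    · exact hr 0 (Fin.pos_iff_ne_zero.2 h0) hj.symm (mem_annihilator.2 lowest_smul_v)
  have h1 (i j : Fin 6) (hij : i ≠ j) (hj : j ≠ 5) : unit i j ∈ annihilator 1 v := by
    by_cases hi : i = 5
    · rw [hi]; exact h5 j hj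
    · exact hl 5 (by omega) hij (h5 j hj)
  have h2 (i : Fin 6) (hi : i ≠ 5) (hi' : i ≠ 0) : unit i 5 ∈ annihilator 1 v :=
    hr 0 (by decide) hi (h1 i 0 hi' (by decide))
  refine eq_top_of_unit_mem (fun i j hij => ?_) fun i hi => ?_
  · by_cases hj : j = 5
    · subst hj
      by_cases h0 : i = 0
      -- The top right corner is reached from the entry below it; the route of `h2` through column 0
      -- would need a diagonal element.
      · exact hl 1 (by rw [h0]; decide) hij (h2 1 (by decide) (by decide))
      · exact h2 i hij h0
    · exact h1 i j hij hj
  · have h : ⁅unit i 5, unit 5 i⁆ = unit i i - unit 5 5 := by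
      rw [unit_lie, if_pos rfl, if_pos rfl]
    rw [← h]
    exact lie_mem_annihilator (upper_mem_annihilator (by omega)) (h5 i hi) (zero_add 1) le_rfl
      zero_le_one

/-- Since sl_6 is perfect, brackets of degree 1 with degree n + 1 fill degree n + 2. -/
theorem annihilator_pos (n : ℕ) : annihilator ((n : ℤ) + 1) v = ⊤ := by
  induction n with
  | zero => simpa using annihilator_one
  | succ n ih =>
    have h (x y : sl6) : ⁅x, y⁆ ∈ annihilator (((n + 1 : ℕ) : ℤ) + 1) v :=
      lie_mem_annihilator (annihilator_one ▸ Submodule.mem_top : x ∈ annihilator 1 v)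
        (ih ▸ Submodule.mem_top : y ∈ annihilator ((n : ℤ) + 1) v) (by push_cast; ring) zero_le_one
        (by omega)
    refine eq_top_of_unit_mem (fun i j hij => ?_) fun i hi => ?_
    · rw [← unit_lie_of_ne i hij]
      exact h _ _
    · have h' : ⁅unit i 5, unit 5 i⁆ = unit i i - unit 5 5 := by
        rw [unit_lie, if_pos rfl, if_pos rfl]
      rw [← h']
      exact h _ _

theorem mode_pos_smul_v (x : sl6) {n : ℤ} (hn : 1 ≤ n) : mode x n • v = 0 := by
  obtain ⟨m, rfl⟩ : ∃ m : ℕ, n = (m : ℤ) + 1 := ⟨(n - 1).toNat, by omega⟩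
  have : x ∈ annihilator ((m : ℤ) + 1) v := by rw [annihilator_pos]; trivial
  exact this

theorem isSingular_v : IsSingular v := by
  refine ⟨v_ne_zero, fun x hx => ?_, fun x n hn => mode_pos_smul_v x hn⟩
  rw [← mem_annihilator, sum_smul_unit x]
  refine Submodule.sum_mem _ fun i _ => Submodule.sum_mem _ fun j _ => ?_
  rcases lt_or_ge i j with h | h
  · exact Submodule.smul_mem _ _ (upper_mem_annihilator h)
  · rw [hx i j h, zero_smul]
    exact Submodule.zero_mem _

/-! ### The weight of the explicit vector -/

/-- The weight of a symbol: the coordinates `1, …, 6` in the dual of the diagonal matrices, and the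
degree in position `0`. -/
def Sym.weight : Sym → ℕ → ℤ
  | .e i j n, c => (if c = i then 1 else 0) - (if c = j then 1 else 0) + if c = 0 then n else 0
  | .f i j n, c => (if c = j then 1 else 0) - (if c = i then 1 else 0) + if c = 0 then n else 0
  | .h _ n, c => if c = 0 then n else 0

/-- The list is degree -4 followed by ε₁ + ε₂ - ε₅ - ε₆, which represents ω₂ + ω₄ on traceless
matrices. -/
theorem weight_vTerms : vTerms.all (fun t => decide ((List.range 7).map
    (fun c => (t.2.map fun s => s.weight c).sum) = [-4, 1, 1, 0, 0, -1, -1])) = true := by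
  decide +kernel

/-- The coordinates of an element of the Cartan subalgebra without its central component. -/
def cartanCoord (H : AffineCartan) (c : ℕ) : ℂ :=
  if c = 0 then H.2.2 else H.1.1.1 (residue (c - 1)) (residue (c - 1))

theorem lie_unit_of_mem_cartan {x : sl6} (hx : x ∈ cartan) (i j : Fin 6) :
    ⁅x, unit i j⁆ = (x.1 i i - x.1 j j) • unit i j := by
  have hx' : x.1 = Matrix.diagonal fun a => x.1 a a := by
    ext a b
    by_cases h : a = b
    · rw [h, Matrix.diagonal_apply_eq]
    · rw [hx a b h, Matrix.diagonal_apply_ne _ h]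
  apply Subtype.ext
  have h' (c : ℂ) (y : sl6) : (c • y).1 = c • y.1 := rfl
  rw [LieAlgebra.SpecialLinear.sl_bracket, h', hx']
  ext a b
  simp only [Matrix.sub_apply, Matrix.diagonal_mul, Matrix.mul_diagonal, Matrix.smul_apply,
    Matrix.diagonal_apply_eq, unit_apply, smul_eq_mul]
  split_ifs <;> subst_vars <;> first | (exfalso; simp_all; done) | ring

theorem cartanAct_smul {k : ℂ} (H : AffineCartan) {x : sl6} {c : ℂ} (hx : ⁅H.1.1, x⁆ = c • x) (n : ℤ)
    (w : V k) : cartanAct k H (mode x n • w) =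
      mode x n • cartanAct k H w + (c + n * H.2.2) • mode x n • w := by
  rw [cartanAct, cartanAct, mode_smul_mode_smul, hx, centralU_smul, centralU_smul, degreeOp_mode,
    mode_smul, zero_add, smul_assoc c, smul_add (mode x n), smul_add (mode x n),
    smul_comm (mode x n) H.2.1, smul_comm (mode x n) k, smul_comm (mode x n) H.2.2, add_smul,
    smul_add, mul_comm (n : ℂ) H.2.2, smul_smul H.2.2]
  have : (if n = 0 then ((0 : ℤ) : ℂ) * form H.1.1 x * k else 0) = 0 := by simp
  rw [this, zero_smul]
  abel

theorem cartanAct_toU {k : ℂ} (H : AffineCartan) {s : Sym} (hs : s.ok = true) (w : V k) :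
    cartanAct k H (s.toU • w) = s.toU • cartanAct k H w +
      (∑ c ∈ Finset.range 7, (s.weight c : ℂ) * cartanCoord H c) • s.toU • w := by
  have hE {i j : ℕ} (hi : 1 ≤ i ∧ i ≤ 6) (hj : 1 ≤ j ∧ j ≤ 6) (hij : i ≠ j) :
      ⁅H.1.1, matrixUnit i j⁆ = (cartanCoord H i - cartanCoord H j) • matrixUnit i j := by
    obtain ⟨i, rfl⟩ : ∃ i' : Fin 6, i = i' + 1 := ⟨⟨i - 1, by omega⟩, by simp; omega⟩
    obtain ⟨j, rfl⟩ : ∃ j' : Fin 6, j = j' + 1 := ⟨⟨j - 1, by omega⟩, by simp; omega⟩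
    have hres (a : Fin 6) : residue a = a := Fin.ext (Nat.mod_eq_of_lt a.2)
    rw [matrixUnit_succ (fun e => hij (by rw [e])), lie_unit_of_mem_cartan H.1.2]
    simp [cartanCoord, hres]
  have hsum (f : ℕ → ℂ) (i j : ℕ) (n : ℤ) (hi : i ≤ 6) (hj : j ≤ 6) :
      ∑ c ∈ Finset.range 7, (((if c = i then 1 else 0) - (if c = j then 1 else 0) +
        if c = 0 then n else 0 : ℤ) : ℂ) * f c = f i - f j + n * f 0 := by
    push_cast
    simp only [add_mul, sub_mul, Finset.sum_add_distrib, Finset.sum_sub_distrib, ite_mul, one_mul,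
      zero_mul, Finset.sum_ite_eq', Finset.mem_range]
    rw [if_pos (by omega), if_pos (by omega), if_pos (by omega)]
  have h0 : cartanCoord H 0 = H.2.2 := rfl
  cases s with
  | e i j n =>
    simp only [Sym.ok, decide_eq_true_eq] at hs
    simp only [Sym.toU, Sym.weight]
    rw [hsum _ i j n (by omega) (by omega), h0]
    exact cartanAct_smul H (hE (by omega) (by omega) (by omega)) n w
  | f i j n =>
    simp only [Sym.ok, decide_eq_true_eq] at hs
    simp only [Sym.toU, Sym.weight]
    rw [hsum _ j i n (by omega) (by omega), h0]
    exact cartanAct_smul H (hE (by omega) (by omega) (by omega)) n w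
  | h i n =>
    simp only [Sym.ok, decide_eq_true_eq] at hs
    simp only [Sym.toU, Sym.weight]
    have h1 := hsum (cartanCoord H) 0 0 n (by omega) (by omega)
    simp only [sub_self, zero_add] at h1
    have h3 := coroot_succ (i := ⟨i - 1, by omega⟩) (j := ⟨i, by omega⟩) (by simp; omega)
    simp only at h3
    have h4 : ⁅H.1.1, coroot i⁆ = (0 : ℂ) • coroot i := by
      rw [h3, lie_sub, lie_unit_of_mem_cartan H.1.2, lie_unit_of_mem_cartan H.1.2]
      simp
    rw [h1, h0]
    simpa using cartanAct_smul H h4 n w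

theorem cartanAct_vac (k : ℂ) (H : AffineCartan) : cartanAct k H (vac k) = (k * H.2.1) • vac k := by
  rw [cartanAct, mode_smul_vac _ le_rfl, centralU_smul, degreeOp_vac, smul_zero, add_zero, zero_add,
    smul_smul, mul_comm]

theorem cartanAct_word {k : ℂ} (H : AffineCartan) {w : List Sym} (hw : w.all Sym.ok = true) :
    cartanAct k H ((w.map Sym.toU).prod • vac k) =
      (k * H.2.1 + ∑ c ∈ Finset.range 7, (((w.map fun s => s.weight c).sum : ℤ) : ℂ) *
        cartanCoord H c) • (w.map Sym.toU).prod • vac k := by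
  induction w with
  | nil => simp [cartanAct_vac]
  | cons s w ih =>
    rw [List.all_cons, Bool.and_eq_true] at hw
    rw [List.map_cons, List.prod_cons, mul_smul, cartanAct_toU H hw.1, ih hw.2, smul_comm s.toU,
      ← add_smul]
    congr 1
    simp only [List.map_cons, List.sum_cons, Int.cast_add, add_mul, Finset.sum_add_distrib]
    ring

theorem cartanAct_add {k : ℂ} (H : AffineCartan) (w w' : V k) :
    cartanAct k H (w + w') = cartanAct k H w + cartanAct k H w' := by
  simp only [cartanAct, smul_add, map_add]
  abel

theorem cartanAct_smul' {k : ℂ} (H : AffineCartan) (c : ℂ) (w : V k) :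
    cartanAct k H (c • w) = c • cartanAct k H w := by
  simp only [cartanAct, smul_add, map_smul]
  rw [smul_comm _ c, smul_comm _ c, smul_comm H.2.1 c, smul_comm H.2.2 c]

theorem hasWeight_v : HasWeight v
    ((-7 / 2 : ℂ) • Lambda0 - (4 : ℂ) • delta + omega 2 + omega 4) := by
  intro H
  have hμ : ((-7 / 2 : ℂ) • Lambda0 - (4 : ℂ) • delta + omega 2 + omega 4) H =
      -7 / 2 * H.2.1 + (-4 * cartanCoord H 0 + cartanCoord H 1 + cartanCoord H 2 -
        cartanCoord H 5 - cartanCoord H 6) := by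
    have ht : ∑ i, H.1.1.1 i i = 0 := LinearMap.mem_ker.1 H.1.1.2
    have hω (i : ℕ) : omega i H = ∑ a : Fin 6, if a.val < i then H.1.1.1 a a else 0 := rfl
    have hr (a : Fin 6) : cartanCoord H (a + 1) = H.1.1.1 a a := by
      have hres : residue a = a := Fin.ext (Nat.mod_eq_of_lt a.2)
      simp [cartanCoord, hres]
    have h1 := hr 0
    have h2 := hr 1
    have h5 := hr 4
    have h6 := hr 5
    simp only [Fin.isValue, Fin.val_zero, Fin.val_one,] at h1 h2 h5 h6
    norm_num at h1 h2 h5 h6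
    rw [h1, h2, h5, h6]
    have h0 : cartanCoord H 0 = H.2.2 := rfl
    have hL : Lambda0 H = H.2.1 := rfl
    have hd : delta H = H.2.2 := rfl
    simp only [LinearMap.add_apply, LinearMap.sub_apply, LinearMap.smul_apply, hL, hd, hω,
      smul_eq_mul, h0]
    rw [Fin.sum_univ_six] at ht
    simp [Fin.sum_univ_six]
    -- ω₂ + ω₄ = 2ε₁ + 2ε₂ + ε₃ + ε₄ differs from ε₁ + ε₂ - ε₅ - ε₆ by the trace.
    linear_combination ht
  have hok := ok_vTerms
  have hwt := weight_vTerms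
  rw [List.all_eq_true] at hok hwt
  rw [hμ, v]
  generalize vTerms = l at hok hwt
  induction l with
  | nil => simp [cartanAct]
  | cons t l ih =>
    rw [List.map_cons, List.sum_cons, cartanAct_add, smul_add,
      ih (fun x hx => hok x (List.mem_cons_of_mem _ hx)) fun x hx => hwt x (List.mem_cons_of_mem _ hx)]
    congr 1
    have h1 := hok t List.mem_cons_self
    have h2 := hwt t List.mem_cons_self
    simp only [Bool.and_eq_true] at h1
    simp only [decide_eq_true_eq, List.range_succ, List.range_zero, List.nil_append,
      List.map_cons, List.map_nil, List.cons_append, List.cons.injEq, and_true] at h2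
    rw [cartanAct_smul', cartanAct_word H h1.2, smul_comm]
    congr 1
    simp only [Finset.sum_range_succ, Finset.sum_range_zero, h2]
    push_cast
    ring

/-! ### The conformal weight of the explicit vector -/

theorem form_comm (x y : sl6) : form x y = form y x := by
  rw [form_apply, form_apply, Matrix.trace_mul_comm]

/-- The map `(x, y) ↦ x(0) y(0) w`. -/
def zeroModes {k : ℂ} (w : V k) : sl6 →ₗ[ℂ] sl6 →ₗ[ℂ] V k :=
  LinearMap.mk₂ ℂ (fun x y => mode x 0 • mode y 0 • w)
    (fun x x' y => by rw [mode_add, add_smul])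
    (fun c x y => by rw [mode_smul, smul_assoc])
    (fun x y y' => by rw [mode_add, add_smul, smul_add])
    (fun c x y => by rw [mode_smul, smul_assoc, smul_comm])

/-- Independence of the Casimir tensor from the dual bases. The traceless units are not a basis, but
`sum_smul_unit` and `form_unit` give them the same expansion property, which is all that is used. -/
theorem sum_dual_bases {M : Type*} [AddCommGroup M] [Module ℂ M] (B : sl6 →ₗ[ℂ] sl6 →ₗ[ℂ] M)
    {ι : Type} [Fintype ι] [DecidableEq ι] (x : Module.Basis ι ℂ sl6) (y : ι → sl6)
    (h : ∀ i j, form (x i) (y j) = if i = j then 1 else 0) :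
    ∑ i, B (x i) (y i) = ∑ a, ∑ b, B (unit b a) (unit a b) := by
  have hx (z : sl6) : ∑ i, form z (y i) • x i = z := by
    have hz (i : ι) : form z (y i) = x.repr z i := by
      conv_lhs => rw [← x.sum_repr z]
      simp only [map_sum, LinearMap.sum_apply, map_smul, LinearMap.smul_apply, h, smul_eq_mul,
        mul_ite, mul_one, mul_zero, Finset.sum_ite_eq', Finset.mem_univ, if_true]
    simp only [hz, x.sum_repr]
  have hy (i : ι) : B (x i) (y i) = ∑ a, ∑ b, form (unit b a) (y i) • B (x i) (unit a b) := by
    conv_lhs => rw [sum_smul_unit (y i)]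
    simp only [map_sum, map_smul, form_comm (unit _ _), form_unit]
  simp only [hy]
  rw [Finset.sum_comm]
  refine Finset.sum_congr rfl fun a _ => ?_
  rw [Finset.sum_comm]
  refine Finset.sum_congr rfl fun b _ => ?_
  conv_rhs => rw [← hx (unit b a)]
  simp

/-- The eigenvalues of the diagonal matrix units on `v`. -/
def topWeight (a : Fin 6) : ℂ := (if a.val < 2 then 1 else 0) + (if a.val < 4 then 1 else 0) - 1

theorem unit_self_smul_v (a : Fin 6) : mode (unit a a) 0 • v = topWeight a • v := by
  have hc : unit a a ∈ cartan := fun i j hij => by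
    rw [unit_apply]
    split_ifs <;> simp_all
  have h := hasWeight_v (⟨unit a a, hc⟩, 0, 0)
  have hω (i : ℕ) : omega i (⟨unit a a, hc⟩, 0, 0) =
      ∑ b : Fin 6, if b.val < i then (unit a a).1 b b else 0 := rfl
  have h1 : Lambda0 (⟨unit a a, hc⟩, 0, 0) = 0 := rfl
  have h2 : delta (⟨unit a a, hc⟩, 0, 0) = 0 := rfl
  rw [cartanAct, zero_smul, zero_smul, add_zero, add_zero] at h
  have h3 : topWeight a = omega 2 (⟨unit a a, hc⟩, 0, 0) + omega 4 (⟨unit a a, hc⟩, 0, 0) := by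
    rw [hω, hω, topWeight]
    simp only [unit_apply, Fin.sum_univ_six, if_true]
    clear h h1 h2 hω hc
    fin_cases a <;> norm_num [Fin.ext_iff]
  rw [h, h3, LinearMap.add_apply, LinearMap.add_apply, LinearMap.sub_apply, LinearMap.smul_apply,
    LinearMap.smul_apply, h1, h2, smul_zero, smul_zero, sub_zero, zero_add]

/-- Only zero modes survive on v. In the Casimir sum over units, raising operators are commuted to
the right, leaving a scalar determined by the weight. -/
theorem hasConformalWeight_v : HasConformalWeight v 4 := by
  intro ι _ _ x y h
  have h0 (z : sl6) (n : ℕ) : mode z (n + 1 : ℤ) • v = 0 := mode_pos_smul_v z (by omega)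
  have h1 : sugawaraL0 (-7 / 2) x y v = (2 * (-7 / 2 + 6) : ℂ)⁻¹ • ∑ i, zeroModes v (x i) (y i) := by
    simp only [sugawaraL0, h0, smul_zero, finsum_zero, add_zero]
    rfl
  have h2 (a b : Fin 6) : zeroModes v (unit b a) (unit a b) =
      (if a < b then 0 else if a = b then topWeight a ^ 2 else topWeight b - topWeight a) • v := by
    change mode (unit b a) 0 • mode (unit a b) 0 • v = _
    rcases lt_trichotomy a b with hab | rfl | hab
    · rw [mem_annihilator.1 (upper_mem_annihilator hab), smul_zero, if_pos hab, zero_smul]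
    · rw [if_neg (lt_irrefl _), if_pos rfl, unit_self_smul_v, smul_comm, unit_self_smul_v, smul_smul,
        sq]
    · rw [if_neg hab.not_gt, if_neg hab.ne', mode_smul_mode_smul,
        mem_annihilator.1 (upper_mem_annihilator hab), smul_zero, zero_add, unit_lie, if_pos rfl,
        if_pos rfl, mode_sub, sub_smul, add_zero, unit_self_smul_v, unit_self_smul_v, ← sub_smul,
        Int.cast_zero, zero_mul, zero_mul, ite_self, zero_smul, add_zero]
  -- With λ = (1, 1, 0, 0, -1, -1) the squares give 4 and the differences λ_b - λ_a over b < a give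
  -- 16. This is (λ, λ + 2ρ) = 20.
  have h3 : ∑ a : Fin 6, ∑ b : Fin 6, (if a < b then 0 else if a = b then topWeight a ^ 2 else
      topWeight b - topWeight a) = 20 := by
    simp only [Fin.sum_univ_six, topWeight]
    norm_num [Fin.ext_iff, Fin.lt_def]
  rw [h1, sum_dual_bases _ x y h]
  simp only [h2, ← Finset.sum_smul]
  rw [h3, smul_smul]
  norm_num

end AffineSl6

end

/-! ### The theorem -/

theorem theorem4p1 :
    AffineSl6.IsSingular AffineSl6.v ∧
      AffineSl6.HasWeight AffineSl6.v
        ((-7 / 2 : ℂ) • AffineSl6.Lambda0 - (4 : ℂ) • AffineSl6.delta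
          + AffineSl6.omega 2 + AffineSl6.omega 4) ∧
      AffineSl6.HasConformalWeight AffineSl6.v 4 ∧
      (∀ i : ℕ, 1 ≤ i → i ≤ 5 →
        AffineSl6.mode (AffineSl6.matrixUnit i (i + 1)) 0 • AffineSl6.v = 0) ∧
      AffineSl6.mode (AffineSl6.matrixUnit 6 1) 1 • AffineSl6.v = 0 := by
  refine ⟨AffineSl6.isSingular_v, AffineSl6.hasWeight_v, AffineSl6.hasConformalWeight_v,
    fun i hi hi' => ?_, AffineSl6.mode_pos_smul_v _ le_rfl⟩
  obtain ⟨i, rfl⟩ : ∃ j, i = j + 1 := ⟨i - 1, by omega⟩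
  have h := AffineSl6.matrixUnit_succ (i := ⟨i, by omega⟩) (j := ⟨i + 1, by omega⟩) (by simp)
  simp only at h
  rw [h]
  exact AffineSl6.simple_smul_v rfl
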